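/- Let $p$ be a prime and let $\mathrm{ord}$ be the valuation of $\mathbb C_p$ with $\mathrm{ord}\,p=1$. Let $\gamma_0\in\mathbb C_p$ be a zero of $\sum_{i\ge0}t^{p^i}/p^i$ with $\mathrm{ord}\,\gamma_0=1/(p-1)$. Put $\theta(t)=\mathrm{AH}(\gamma_0t)$, where $\mathrm{AH}(t)=\exp\big(\sum_{i\ge0}t^{p^i}/p^i\big)$, and $$\gamma_j=\sum_{i=0}^{j}\frac{\gamma_0^{p^i}}{p^i},\qquad \hat\theta_1(t)=\prod_{j\ge1}\exp(\gamma_jt^{p^j}),\qquad \zeta(t)=\sum_{i\ge0}(-1)^i\,i!\,t^{-i-1}.$$ Let $n\ge1$, $0\le M\le N$, and let $\mathbf a_1,\dots,\mathbf a_N\in\mathbb Z^n$ be vectors with last coordinate $1$; write $A=\{\mathbf a_j\}_{j=1}^N$. Let $C(A)\subseteq\mathbb R^n$ be the real cone generated by $A$, $C(A)^\circ$ its relative interior, $\mathbb ZA$ the group generated by $A$, and $\mathcal M=(-C(A)^\circ)\cap\mathbb ZA$. For a formal series in the monomials $\Lambda^\mu x^u$ ($\mu\in\mathbb Z^N$,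 $u\in\mathbb Z^n$) let $\delta_{\mathcal M}$ keep the terms with $u\in\mathcal M$ and delete the others. Define $$G(\Lambda,x)=\delta_{\mathcal M}\Big(\prod_{j=1}^{M}\zeta(\gamma_0\Lambda_jx^{\mathbf a_j})\,\hat\theta_1(\Lambda_jx^{\mathbf a_j})\prod_{j=M+1}^{N}\exp(\gamma_0\Lambda_jx^{\mathbf a_j})\,\hat\theta_1(\Lambda_jx^{\mathbf a_j})\Big),$$ $$\theta(\Lambda,x)=\prod_{j=1}^{N}\theta(\Lambda_jx^{\mathbf a_j}),\qquad \alpha^*\big(G(\Lambda,x)\big)=\delta_{\mathcal M}\big(\theta(\Lambda,x)\,G(\Lambda^p,x^p)\big),$$ where $\Lambda^p=(\Lambda_1^p,\dots,\Lambda_N^p)$ and $x^p=(x_1^p,\dots,x_n^p)$. Assume that $A'=\{\mathbf a_j\}_{j=1}^M$ is minimal for $C(A)^\circ$, i.e. $\sum_{j=1}^M\mathbf a_j\in C(A)^\circ$ and $\sum_{j\in J}\mathbf a_j\notin C(A)^\circ$ for every proper subset $J$ of $\{1,\dots,M\}$. **Theorem.** The series for the coefficients of the product $\zeta(\gamma_0t)\hat\theta_1(t)$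 and, for all $\mu\in\mathbb Z^N$ and $\rho\in\mathcal M$, the series for the coefficient of $\Lambda^\mu x^\rho$ in $\theta(\Lambda,x)G(\Lambda^p,x^p)$ converge unconditionally in $\mathbb C_p$, so that $G$ and $\alpha^*(G)$ are well defined. Moreover $G(\Lambda,x)$ is an eigenvector of $\alpha^*$ with eigenvalue $p^M$: $G\neq0$ and $$\alpha^*\big(G(\Lambda,x)\big)=p^M\,G(\Lambda,x).$$ -/

import Mathlib

namespace DworkFrobenius

noncomputable section

open scoped PowerSeries Nat

/-! ### The lattice data -/

section Lattice

variable {n N : ℕ}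

/-- An integral vector, seen in `ℝⁿ`. -/
def toReal (u : Fin n → ℤ) : Fin n → ℝ := fun i => (u i : ℝ)

/-- The real cone `C(A) ⊆ ℝⁿ` generated by the vectors `a j`. -/
def cone (a : Fin N → Fin n → ℤ) : Set (Fin n → ℝ) :=
  (PointedCone.hull ℝ (Set.range fun j => toReal (a j)) : Set (Fin n → ℝ))

/-- The relative interior `C(A)°` of the cone `C(A)`. -/
def coneInterior (a : Fin N → Fin n → ℤ) : Set (Fin n → ℝ) :=
  intrinsicInterior ℝ (cone a)

/-- `A' = {a_1, …, a_M}` is minimal for `C(A)°`: the sum of the vectors of `A'` lies in `C(A)°`,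
and no sum over a proper subset `J` of the index set of `A'` does. -/
def IsMinimalFor (M : ℕ) (a : Fin N → Fin n → ℤ) : Prop :=
  toReal (∑ j : Fin N with j.val < M, a j) ∈ coneInterior a ∧
    ∀ J : Finset (Fin N), J ⊂ Finset.univ.filter (fun j => j.val < M) →
      toReal (∑ j ∈ J, a j) ∉ coneInterior a

/-- `ℳ = (-C(A)°) ∩ ℤA`, where `ℤA` is the group generated by `A`. -/
def negInteriorLattice (a : Fin N → Fin n → ℤ) : Set (Fin n → ℤ) :=
  {u | -toReal u ∈ coneInterior a ∧ u ∈ AddSubgroup.closure (Set.range a)}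

end Lattice

variable {p : ℕ} [Fact p.Prime]

/-! ### Series in one variable over `ℂ_p` -/

/-- The coefficients of the series `∑_{i ≥ 0} t^(p^i) / p^i`. -/
def dworkLogCoeff (p : ℕ) [Fact p.Prime] (k : ℕ) : ℂ_[p] :=
  open Classical in if ∃ i : ℕ, k = p ^ i then (k : ℂ_[p])⁻¹ else 0

/-- The Artin-Hasse series `AH(t) = exp(∑_{i ≥ 0} t^(p^i) / p^i)`. -/
def artinHasse (p : ℕ) [Fact p.Prime] : ℂ_[p]⟦X⟧ :=
  (PowerSeries.exp ℂ_[p]).subst (PowerSeries.mk (dworkLogCoeff p))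

/-- `γ₀` is a zero of `∑_{i ≥ 0} t^(p^i) / p^i` with `ord γ₀ = 1 / (p - 1)`, where `ord p = 1`. -/
def IsDworkZero (γ₀ : ℂ_[p]) : Prop :=
  HasSum (fun i : ℕ => γ₀ ^ p ^ i / (p : ℂ_[p]) ^ i) 0 ∧
    ‖γ₀‖ = (p : ℝ) ^ (-(1 / ((p : ℝ) - 1)))

/-- `θ(t) = AH(γ₀ t)`. -/
def theta (γ₀ : ℂ_[p]) : ℂ_[p]⟦X⟧ := PowerSeries.rescale γ₀ (artinHasse p)

/-- `γ_j = ∑_{i = 0}^j γ₀^(p^i) / p^i`. -/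
def gammaSeq (γ₀ : ℂ_[p]) (j : ℕ) : ℂ_[p] :=
  ∑ i ∈ Finset.range (j + 1), γ₀ ^ p ^ i / (p : ℂ_[p]) ^ i

/-- The series `exp(γ_j t^(p^j))`. -/
def expFactor (γ₀ : ℂ_[p]) (j : ℕ) : ℂ_[p]⟦X⟧ :=
  (PowerSeries.exp ℂ_[p]).subst
    (PowerSeries.C (gammaSeq γ₀ j) * PowerSeries.X ^ p ^ j : ℂ_[p]⟦X⟧)

/-- `θ̂₁(t) = ∏_{j ≥ 1} exp(γ_j t^(p^j))`. The `j`-th factor is `1` up to terms of degree at least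
`p^j > j`, so the coefficient of `t^k` is that in the product of the factors `1 ≤ j ≤ k`. -/
def thetaHatOne (γ₀ : ℂ_[p]) : ℂ_[p]⟦X⟧ :=
  PowerSeries.mk fun k => PowerSeries.coeff k (∏ j ∈ Finset.Icc 1 k, expFactor γ₀ j)

/-- The doubly infinite coefficient sequence of a power series. -/
def ofPowerSeries (f : ℂ_[p]⟦X⟧) (k : ℤ) : ℂ_[p] :=
  if 0 ≤ k then PowerSeries.coeff k.toNat f else 0

/-- The coefficient of `t^k` in `ζ(γ₀ t)`, where `ζ(t) = ∑_{i ≥ 0} (-1)^i i! t^(-i-1)`. -/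
def zetaCoeff (γ₀ : ℂ_[p]) (k : ℤ) : ℂ_[p] :=
  if k < 0 then (-1) ^ (-k - 1).toNat * ((-k - 1).toNat ! : ℂ_[p]) * γ₀ ^ k else 0

/-- The coefficients of `exp(γ₀ t) θ̂₁(t)`. -/
def expThetaCoeff (γ₀ : ℂ_[p]) : ℤ → ℂ_[p] :=
  ofPowerSeries (PowerSeries.rescale γ₀ (PowerSeries.exp ℂ_[p]) * thetaHatOne γ₀)

/-! ### Formal two-sided series, given by their coefficients -/

section Formal

variable {E : Type*} [AddCommGroup E]

/-- The terms whose sum over `d` is the coefficient at the exponent `e` in the product of the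
two formal series with coefficients `f` and `g`. -/
def mulTerm (f g : E → ℂ_[p]) (e d : E) : ℂ_[p] := f d * g (e - d)

/-- The coefficients of the product of two formal series (meaningful at the exponents `e` for which
`mulTerm f g e` is summable). -/
def formalMul (f g : E → ℂ_[p]) (e : E) : ℂ_[p] := ∑' d, mulTerm f g e d

end Formal

/-- The coefficients of `ζ(γ₀ t) θ̂₁(t)`. -/
def zetaThetaCoeff (γ₀ : ℂ_[p]) : ℤ → ℂ_[p] :=
  formalMul (zetaCoeff γ₀) (ofPowerSeries (thetaHatOne γ₀))

/-- Formal series over `ℂ_p` in the monomials `Λ^μ x^u`, `(μ, u) ∈ ℤᴺ × ℤⁿ`. -/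
abbrev LambdaXSeries (p : ℕ) [Fact p.Prime] (N n : ℕ) : Type :=
  (Fin N → ℤ) × (Fin n → ℤ) → ℂ_[p]

section Series

variable {n N : ℕ}

/-- The product `∏_j f_j(Λ_j x^(a_j))` of one-variable series `f_j(t) = ∑_k f_j(k) t^k`. The monomial
`∏_j (Λ_j x^(a_j))^(μ_j)` is the only one in the expansion with `Λ`-exponent `μ`, and it is
`Λ^μ x^u` with `u = ∑_j μ_j a_j`. -/
def prodSubst (a : Fin N → Fin n → ℤ) (f : Fin N → ℤ → ℂ_[p]) : LambdaXSeries p N n :=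
  fun e => if e.2 = ∑ j, e.1 j • a j then ∏ j, f j (e.1 j) else 0

/-- `δ_S`: keep the terms with `x`-exponent in `S`. -/
def delta (S : Set (Fin n → ℤ)) (f : LambdaXSeries p N n) : LambdaXSeries p N n :=
  open Classical in fun e => if e.2 ∈ S then f e else 0

/-- `f(Λ^p, x^p)`. -/
def frobSubst (f : LambdaXSeries p N n) : LambdaXSeries p N n :=
  fun e => if (∀ j, (p : ℤ) ∣ e.1 j) ∧ (∀ i, (p : ℤ) ∣ e.2 i) then
    f (fun j => e.1 j / (p : ℤ), fun i => e.2 i / (p : ℤ)) else 0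

/-- `θ(Λ, x) = ∏_{j = 1}^N θ(Λ_j x^(a_j))`. -/
def thetaSeries (γ₀ : ℂ_[p]) (a : Fin N → Fin n → ℤ) : LambdaXSeries p N n :=
  prodSubst a fun _ => ofPowerSeries (theta γ₀)

/-- The `p`-adically normalized generating series
`G(Λ, x) = δ_ℳ(∏_{j ≤ M} ζ(γ₀ Λ_j x^(a_j)) θ̂₁(Λ_j x^(a_j)) · ∏_{j > M} exp(γ₀ Λ_j x^(a_j)) θ̂₁(Λ_j x^(a_j)))`. -/
def genSeries (γ₀ : ℂ_[p]) (M : ℕ) (a : Fin N → Fin n → ℤ) : LambdaXSeries p N n :=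
  delta (negInteriorLattice a)
    (prodSubst a fun j => if j.val < M then zetaThetaCoeff γ₀ else expThetaCoeff γ₀)

/-- The Dwork-Frobenius operator `α*(f) = δ_ℳ(θ(Λ, x) f(Λ^p, x^p))`. -/
def dworkFrobenius (γ₀ : ℂ_[p]) (a : Fin N → Fin n → ℤ) (f : LambdaXSeries p N n) :
    LambdaXSeries p N n :=
  delta (negInteriorLattice a) (formalMul (thetaSeries γ₀ a) (frobSubst f))

/-- `α*(f)` is well defined: for `ρ ∈ ℳ` the series for the coefficient of `Λ^μ x^ρ` in the product
`θ(Λ, x) f(Λ^p, x^p)` converges. -/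
def DworkFrobeniusConverges (γ₀ : ℂ_[p]) (a : Fin N → Fin n → ℤ) (f : LambdaXSeries p N n) :
    Prop :=
  ∀ μ : Fin N → ℤ, ∀ ρ ∈ negInteriorLattice a,
    Summable (mulTerm (thetaSeries γ₀ a) (frobSubst f) (μ, ρ))

end Series

end

end DworkFrobenius

/-!
With `θ̂(t) = exp(γ₀ t) θ̂₁(t) = ∏_{i ≥ 0} θ(t ^ p ^ i)` one has `θ(t) θ̂(t ^ p) = θ̂(t)`
(`theta_mul_expand`). The series `q(t) = ζ(γ₀ t) θ̂₁(t)` is its counterpart in negative degrees, and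
satisfies `θ(t) q(t ^ p) = p q(t)` in all negative degrees
(`theta_formalMul_frobOne_zetaThetaCoeff`). For this, put
`E(t) = θ(t) θ̂₁(t ^ p) / θ̂₁(t) = exp(γ₀ (t - t ^ p))`, so that
`θ(t) q(t ^ p) = θ̂₁(t) · E(t) ζ(γ₀ t ^ p)`. Multiplication by the power series `θ̂₁` only lets the
principal part of `w(t) = E(t) ζ(γ₀ t ^ p)` act on negative degrees, and `t ζ' = t ζ - 1` yields
`t w' = γ₀ t w - p E`. In degrees `≤ 0` this is, up to the factor `p`, the equation of `ζ(γ₀ t)`, so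
the principal part of `w` is `p ζ(γ₀ t)`. The same argument with `θ̂₁⁻¹` shows that the principal
part of `q` is not zero, which gives `G ≠ 0`.

All rearrangements are legitimate because `θ`, `θ̂₁` and `E` converge on a disc of radius larger than
`1`, while the coefficients of `ζ(γ₀ t)` have norm `|γ₀| ^ (-s_p(i) - 1)`, of at most linear growth.
The first fact rests on the integrality of the Artin-Hasse series, proved by Dwork's criterion
(`norm_coeff_le_one_of_expand_eq`), and on the smallness of `γ_j`, a partial sum of a series with
sum `0` (`IsDworkZero.norm_gammaSeq_le`).

The relative interior of the cone `C(A)` absorbs elements of `C(A)` and is stable under positive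
scaling. Hence the inner `δ_ℳ` in `α*(G)` can be dropped in degrees `ρ ∈ ℳ`, and the coefficient of
`Λ ^ μ x ^ ρ`, `ρ = ∑ μ_j a_j`, is a product over `j` of one-variable coefficients
(`formalMul_genSeries`). Minimality of `A'` forces `μ_j < 0` for all `j ≤ M` as soon as `μ_j ≥ 0` for
all `j > M` (`neg_of_mem_negInteriorLattice`). So each `j ≤ M` contributes a factor `p` and each
`j > M` a factor `1`.
-/

namespace DworkFrobenius

noncomputable section

open scoped PowerSeries Nat
open Filter Topology

variable {p : ℕ} [Fact p.Prime]

/-! ### Convolution of overconvergent power series with two-sided series -/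

/-- The coefficients of `f` are bounded by `r ^ i` for every `r < 1` close enough to `1`. In
particular `f` converges on a disc of radius larger than `1`. -/
def Overconvergent (f : ℂ_[p]⟦X⟧) : Prop :=
  ∀ᶠ r in 𝓝[<] (1 : ℝ), ∀ i, ‖PowerSeries.coeff i f‖ ≤ r ^ i

/-- The coefficients of a two-sided series `h` are bounded by a multiple of `s ^ k` for every
`s < 1` close enough to `1`: they grow subexponentially at `-∞` and decay at `+∞`. -/
def SubexponentialGrowth (h : ℤ → ℂ_[p]) : Prop :=
  ∀ᶠ s in 𝓝[<] (1 : ℝ), ∃ C, ∀ k : ℤ, ‖h k‖ ≤ C * s ^ k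

lemma eventually_gt_lt_one {r : ℝ} (hr : r < 1) : ∀ᶠ s in 𝓝[<] (1 : ℝ), r < s ∧ s < 1 :=
  Ioo_mem_nhdsLT hr

lemma overconvergent_of_le {f : ℂ_[p]⟦X⟧} {r : ℝ} (hr0 : 0 ≤ r) (hr : r < 1)
    (h : ∀ i, ‖PowerSeries.coeff i f‖ ≤ r ^ i) : Overconvergent f := by
  filter_upwards [eventually_gt_lt_one hr] with s hs i
  exact (h i).trans (pow_le_pow_left₀ hr0 hs.1.le i)

lemma ofPowerSeries_natCast (f : ℂ_[p]⟦X⟧) (k : ℕ) :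
    ofPowerSeries f k = PowerSeries.coeff k f := by
  simp [ofPowerSeries]

lemma ofPowerSeries_of_neg (f : ℂ_[p]⟦X⟧) {k : ℤ} (hk : k < 0) : ofPowerSeries f k = 0 := by
  simp [ofPowerSeries, hk]

lemma norm_ofPowerSeries_le {f : ℂ_[p]⟦X⟧} {r : ℝ} (hr : 0 ≤ r)
    (h : ∀ i, ‖PowerSeries.coeff i f‖ ≤ r ^ i) (k : ℤ) : ‖ofPowerSeries f k‖ ≤ r ^ k := by
  rcases lt_or_ge k 0 with hk | hk
  · rw [ofPowerSeries_of_neg f hk, norm_zero]; positivity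
  · lift k to ℕ using hk
    rw [ofPowerSeries_natCast, zpow_natCast]; exact h k

lemma norm_coeff_mul_le {f g : ℂ_[p]⟦X⟧} {r : ℝ} (hr : 0 ≤ r)
    (hf : ∀ i, ‖PowerSeries.coeff i f‖ ≤ r ^ i) (hg : ∀ i, ‖PowerSeries.coeff i g‖ ≤ r ^ i)
    (i : ℕ) : ‖PowerSeries.coeff i (f * g)‖ ≤ r ^ i := by
  rw [PowerSeries.coeff_mul]
  refine IsUltrametricDist.norm_sum_le_of_forall_le_of_nonneg (pow_nonneg hr i) ?_
  rintro ⟨a, b⟩ hab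
  rw [Finset.HasAntidiagonal.mem_antidiagonal] at hab
  rw [norm_mul, ← hab, pow_add]
  exact mul_le_mul (hf a) (hg b) (norm_nonneg _) (pow_nonneg hr _)

lemma Overconvergent.mul {f g : ℂ_[p]⟦X⟧} (hf : Overconvergent f) (hg : Overconvergent g) :
    Overconvergent (f * g) := by
  filter_upwards [hf, hg, eventually_gt_lt_one zero_lt_one] with r h1 h2 hr
  exact norm_coeff_mul_le hr.1.le h1 h2

lemma Overconvergent.inv {f : ℂ_[p]⟦X⟧} (hf : Overconvergent f)
    (h0 : PowerSeries.constantCoeff f = 1) : Overconvergent f⁻¹ := by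
  filter_upwards [hf, eventually_gt_lt_one zero_lt_one] with r h1 hr i
  induction i using Nat.strong_induction_on with
  | _ i ih =>
  rw [PowerSeries.coeff_inv]
  split_ifs with hi
  · simp [hi, h0]
  · rw [h0, inv_one, neg_one_mul, norm_neg]
    refine IsUltrametricDist.norm_sum_le_of_forall_le_of_nonneg (pow_nonneg hr.1.le i) ?_
    rintro ⟨a, b⟩ hab
    rw [Finset.HasAntidiagonal.mem_antidiagonal] at hab
    split_ifs with hb
    · rw [norm_mul, ← hab, pow_add]
      exact mul_le_mul (h1 a) (ih b hb) (norm_nonneg _) (pow_nonneg hr.1.le _)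
    · rw [norm_zero]; exact pow_nonneg hr.1.le i

lemma tendsto_pow_nhdsLT_one {n : ℕ} (hn : n ≠ 0) :
    Tendsto (fun s : ℝ => s ^ n) (𝓝[<] 1) (𝓝[<] 1) := by
  refine tendsto_nhdsWithin_iff.2 ⟨?_, ?_⟩
  · have : Tendsto (fun s : ℝ => s ^ n) (𝓝 1) (𝓝 (1 ^ n)) := (continuous_pow n).tendsto 1
    rw [one_pow] at this
    exact this.mono_left nhdsWithin_le_nhds
  · filter_upwards [eventually_gt_lt_one zero_lt_one] with s hs
    exact pow_lt_one₀ hs.1.le hs.2 hn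

lemma Overconvergent.expand {f : ℂ_[p]⟦X⟧} (hf : Overconvergent f) {n : ℕ} (hn : n ≠ 0) :
    Overconvergent (f.expand n hn) := by
  filter_upwards [(tendsto_pow_nhdsLT_one hn).eventually hf, eventually_gt_lt_one zero_lt_one]
    with s hs hs0 i
  by_cases hi : n ∣ i
  · obtain ⟨m, rfl⟩ := hi
    rw [PowerSeries.coeff_expand_mul, pow_mul]
    exact hs m
  · rw [PowerSeries.coeff_expand_of_not_dvd _ _ _ hi, norm_zero]
    exact pow_nonneg hs0.1.le i

/-- The weighted norms that control all the convolutions below. -/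
lemma summable_norm_ofPowerSeries_mul {f : ℂ_[p]⟦X⟧} {r s : ℝ} (hr : 0 < r) (hrs : r < s)
    (h : ∀ i, ‖PowerSeries.coeff i f‖ ≤ r ^ i) :
    Summable fun k : ℤ => ‖ofPowerSeries f k‖ * s ^ (-k) := by
  have hs : 0 < s := hr.trans hrs
  rw [← Function.Injective.summable_iff (Nat.cast_injective (R := ℤ))]
  · refine Summable.of_nonneg_of_le (fun i => ?_) (fun i => ?_)
      (summable_geometric_of_lt_one (r := r / s) (by positivity) ((div_lt_one hs).2 hrs))
    · simp only [Function.comp]; positivity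
    · simp only [Function.comp, ofPowerSeries_natCast]
      rw [zpow_neg, zpow_natCast, div_pow, div_eq_mul_inv]
      exact mul_le_mul_of_nonneg_right (h i) (by positivity)
  · intro k hk
    have : k < 0 := by
      by_contra! hk'
      exact hk ⟨k.toNat, by simpa using hk'⟩
    rw [ofPowerSeries_of_neg f this, norm_zero, zero_mul]

lemma SubexponentialGrowth.exists_bound {h : ℤ → ℂ_[p]} (hh : SubexponentialGrowth h) {r : ℝ}
    (hr : r < 1) : ∃ s, r < s ∧ s < 1 ∧ ∃ C, ∀ k : ℤ, ‖h k‖ ≤ C * s ^ k := by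
  obtain ⟨s, h1, h2⟩ := (hh.and (eventually_gt_lt_one hr)).exists
  exact ⟨s, h2.1, h2.2, h1⟩

lemma Overconvergent.exists_bound {f : ℂ_[p]⟦X⟧} (hf : Overconvergent f) {r : ℝ}
    (hr : r < 1) : ∃ s, r < s ∧ s < 1 ∧ ∀ k, ‖PowerSeries.coeff k f‖ ≤ s ^ k := by
  obtain ⟨s, h1, h2⟩ := (Eventually.and hf (eventually_gt_lt_one hr)).exists
  exact ⟨s, h2.1, h2.2, h1⟩

lemma summable_norm_mulTerm {f : ℂ_[p]⟦X⟧} {h : ℤ → ℂ_[p]} (hf : Overconvergent f)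
    (hh : SubexponentialGrowth h) (k : ℤ) :
    Summable fun d => ‖mulTerm (ofPowerSeries f) h k d‖ := by
  obtain ⟨r, hr0, hr1, hfr⟩ := hf.exists_bound zero_lt_one
  obtain ⟨s, hrs, -, C, hC⟩ := hh.exists_bound hr1
  have hs : 0 < s := hr0.trans hrs
  refine Summable.of_nonneg_of_le (fun _ => norm_nonneg _) (fun d => ?_)
    ((summable_norm_ofPowerSeries_mul hr0 hrs hfr).mul_right (C * s ^ k))
  rw [mulTerm, norm_mul, mul_assoc]
  refine mul_le_mul_of_nonneg_left ((hC _).trans_eq ?_) (norm_nonneg _)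
  rw [sub_eq_add_neg, zpow_add₀ hs.ne']; ring

lemma summable_mulTerm {f : ℂ_[p]⟦X⟧} {h : ℤ → ℂ_[p]} (hf : Overconvergent f)
    (hh : SubexponentialGrowth h) (k : ℤ) : Summable (mulTerm (ofPowerSeries f) h k) :=
  (summable_norm_mulTerm hf hh k).of_norm

lemma SubexponentialGrowth.formalMul {f : ℂ_[p]⟦X⟧} {h : ℤ → ℂ_[p]} (hf : Overconvergent f)
    (hh : SubexponentialGrowth h) : SubexponentialGrowth (formalMul (ofPowerSeries f) h) := by
  filter_upwards [hf, hh, eventually_gt_lt_one zero_lt_one] with s hs ⟨C, hC⟩ hs0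
  have hs1 : 0 < s := hs0.1
  refine ⟨C, fun k => ?_⟩
  have hC0 : 0 ≤ C := by simpa using (norm_nonneg _).trans (hC 0)
  refine IsUltrametricDist.norm_tsum_le_of_forall_le_of_nonneg (by positivity) fun d => ?_
  rw [mulTerm, norm_mul]
  refine (mul_le_mul (norm_ofPowerSeries_le hs0.1.le hs d) (hC _) (norm_nonneg _)
    (by positivity)).trans_eq ?_
  rw [zpow_sub₀ hs1.ne']
  field_simp

lemma formalMul_comm (f g : ℤ → ℂ_[p]) : formalMul f g = formalMul g f := by
  funext k
  rw [formalMul, formalMul, ← (Equiv.subLeft k).tsum_eq (mulTerm f g k)]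
  refine tsum_congr fun d => ?_
  simp [mulTerm, mul_comm]

lemma summable_mulTerm_comm {f g : ℤ → ℂ_[p]} {k : ℤ} (h : Summable (mulTerm f g k)) :
    Summable (mulTerm g f k) := by
  rw [← (Equiv.subLeft k).summable_iff]
  refine h.congr fun d => ?_
  simp [mulTerm, mul_comm]

lemma formalMul_ofPowerSeries (f g : ℂ_[p]⟦X⟧) :
    formalMul (ofPowerSeries f) (ofPowerSeries g) = ofPowerSeries (f * g) := by
  funext k
  rcases lt_or_ge k 0 with hk | hk
  · rw [ofPowerSeries_of_neg _ hk, formalMul]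
    refine (tsum_congr fun d => ?_).trans tsum_zero
    rcases lt_or_ge d 0 with hd | hd
    · rw [mulTerm, ofPowerSeries_of_neg f hd, zero_mul]
    · rw [mulTerm, ofPowerSeries_of_neg g (by lia), mul_zero]
  · lift k to ℕ using hk
    rw [ofPowerSeries_natCast, PowerSeries.coeff_mul, formalMul,
      Finset.Nat.sum_antidiagonal_eq_sum_range_succ
        (fun i j => PowerSeries.coeff i f * PowerSeries.coeff j g),
      tsum_eq_sum (s := (Finset.range (k + 1)).map Nat.castEmbedding), Finset.sum_map]
    · refine Finset.sum_congr rfl fun i hi => ?_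
      have hi' : i ≤ k := by simpa [Nat.lt_succ_iff] using hi
      rw [mulTerm, Nat.castEmbedding_apply, ofPowerSeries_natCast, ← Nat.cast_sub hi',
        ofPowerSeries_natCast]
    · intro d hd
      rcases lt_or_ge d 0 with hd0 | hd0
      · rw [mulTerm, ofPowerSeries_of_neg f hd0, zero_mul]
      · lift d to ℕ using hd0
        rw [mulTerm, ofPowerSeries_of_neg g, mul_zero]
        simp only [Finset.mem_map, Finset.mem_range, Nat.castEmbedding_apply, Nat.cast_inj,
          exists_eq_right] at hd
        lia

/-- Associativity of the convolution; the triple sums converge absolutely. -/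
lemma formalMul_mul {f g : ℂ_[p]⟦X⟧} {h : ℤ → ℂ_[p]} (hf : Overconvergent f)
    (hg : Overconvergent g) (hh : SubexponentialGrowth h) :
    formalMul (ofPowerSeries (f * g)) h =
      formalMul (ofPowerSeries f) (formalMul (ofPowerSeries g) h) := by
  funext k
  obtain ⟨r, hr0, hr1, hfr⟩ := hf.exists_bound zero_lt_one
  obtain ⟨r', hr0', hr1', hgr⟩ := hg.exists_bound zero_lt_one
  obtain ⟨s, hrs, -, C, hC⟩ := hh.exists_bound (max_lt hr1 hr1')
  have hs : 0 < s := hr0.trans ((le_max_left _ _).trans_lt hrs)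
  set F : ℤ × ℤ → ℂ_[p] := fun q =>
    ofPowerSeries f q.1 * (ofPowerSeries g q.2 * h (k - q.1 - q.2)) with hF
  have hFs : Summable F := by
    refine Summable.of_norm_bounded (((summable_norm_ofPowerSeries_mul hr0
      ((le_max_left _ _).trans_lt hrs) hfr).mul_of_nonneg (summable_norm_ofPowerSeries_mul
      hr0' ((le_max_right _ _).trans_lt hrs) hgr) (fun i => by positivity)
      (fun i => by positivity)).mul_right (C * s ^ k)) fun q => ?_
    rw [hF, norm_mul, norm_mul]
    refine (mul_le_mul_of_nonneg_left (mul_le_mul_of_nonneg_left (hC _) (norm_nonneg _))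
      (norm_nonneg _)).trans_eq ?_
    rw [sub_eq_add_neg, sub_eq_add_neg, zpow_add₀ hs.ne', zpow_add₀ hs.ne']
    ring
  have e1 : ∑' q, F q = formalMul (ofPowerSeries f) (formalMul (ofPowerSeries g) h) k := by
    rw [hFs.tsum_prod, formalMul]
    refine tsum_congr fun i => ?_
    rw [mulTerm, formalMul, ← tsum_mul_left]
    rfl
  let e : ℤ × ℤ ≃ ℤ × ℤ :=
    { toFun := fun q => (q.2, q.1 - q.2)
      invFun := fun q => (q.1 + q.2, q.1)
      left_inv := fun q => by simp
      right_inv := fun q => by simp }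
  have hFe : Summable fun q => F (e q) := e.summable_iff.2 hFs
  rw [← e1, ← e.tsum_eq, hFe.tsum_prod, formalMul]
  refine tsum_congr fun m => ?_
  rw [mulTerm, ← formalMul_ofPowerSeries, formalMul, ← tsum_mul_right]
  refine tsum_congr fun i => ?_
  simp [hF, e, mulTerm, mul_assoc]

lemma ofPowerSeries_one (k : ℤ) : ofPowerSeries (1 : ℂ_[p]⟦X⟧) k = if k = 0 then 1 else 0 := by
  rcases lt_or_ge k 0 with hk | hk
  · rw [ofPowerSeries_of_neg _ hk, if_neg hk.ne]
  · lift k to ℕ using hk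
    simp [ofPowerSeries_natCast, PowerSeries.coeff_one]

lemma one_formalMul (h : ℤ → ℂ_[p]) : formalMul (ofPowerSeries 1) h = h := by
  funext k
  rw [formalMul, tsum_eq_single 0]
  · simp [mulTerm, ofPowerSeries_one]
  · intro d hd; simp [mulTerm, ofPowerSeries_one, hd]

/-- Multiplication by a power series does not mix nonnegative powers into the principal part. -/
lemma formalMul_eq_of_eqOn_neg (f : ℂ_[p]⟦X⟧) {h h' : ℤ → ℂ_[p]} (hh : ∀ k < 0, h k = h' k)
    {k : ℤ} (hk : k < 0) :
    formalMul (ofPowerSeries f) h k = formalMul (ofPowerSeries f) h' k := by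
  refine tsum_congr fun d => ?_
  rcases lt_or_ge d 0 with hd | hd
  · simp [mulTerm, ofPowerSeries_of_neg f hd]
  · rw [mulTerm, mulTerm, hh (k - d) (by lia)]

/-- The coefficients of `h(t ^ p)`. -/
def frobOne (h : ℤ → ℂ_[p]) (k : ℤ) : ℂ_[p] := if (p : ℤ) ∣ k then h (k / p) else 0

lemma prime_ne_zero : p ≠ 0 := (Fact.out : p.Prime).ne_zero

lemma frobOne_mul (h : ℤ → ℂ_[p]) (k : ℤ) : frobOne h (p * k) = h k := by
  have : (p : ℤ) ≠ 0 := by exact_mod_cast prime_ne_zero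
  rw [frobOne, if_pos (dvd_mul_right _ _), Int.mul_ediv_cancel_left _ this]

lemma frobOne_of_not_dvd (h : ℤ → ℂ_[p]) {k : ℤ} (hk : ¬ (p : ℤ) ∣ k) : frobOne h k = 0 :=
  if_neg hk

lemma SubexponentialGrowth.frobOne {h : ℤ → ℂ_[p]} (hh : SubexponentialGrowth h) :
    SubexponentialGrowth (frobOne h) := by
  filter_upwards [(tendsto_pow_nhdsLT_one (prime_ne_zero (p := p))).eventually hh,
    eventually_gt_lt_one zero_lt_one] with s ⟨C, hC⟩ hs0
  have hs1 : 0 < s := hs0.1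
  have hC0 : 0 ≤ C := by simpa using (norm_nonneg _).trans (hC 0)
  refine ⟨C, fun k => ?_⟩
  by_cases hk : (p : ℤ) ∣ k
  · obtain ⟨m, rfl⟩ := hk
    rw [frobOne_mul, zpow_mul, zpow_natCast]
    exact hC m
  · rw [frobOne_of_not_dvd _ hk, norm_zero]; positivity

lemma frobOne_ofPowerSeries (f : ℂ_[p]⟦X⟧) :
    frobOne (ofPowerSeries f) = ofPowerSeries (f.expand p prime_ne_zero) := by
  have hp : (0 : ℤ) < p := by exact_mod_cast (Fact.out : p.Prime).pos
  funext k
  by_cases hk : (p : ℤ) ∣ k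
  · obtain ⟨m, rfl⟩ := hk
    rw [frobOne_mul]
    rcases lt_or_ge m 0 with hm | hm
    · rw [ofPowerSeries_of_neg _ hm, ofPowerSeries_of_neg _ (by nlinarith)]
    · lift m to ℕ using hm
      rw [← Nat.cast_mul, ofPowerSeries_natCast, ofPowerSeries_natCast,
        PowerSeries.coeff_expand_mul]
  · rw [frobOne_of_not_dvd _ hk]
    rcases lt_or_ge k 0 with hm | hm
    · rw [ofPowerSeries_of_neg _ hm]
    · lift k to ℕ using hm
      rw [ofPowerSeries_natCast, PowerSeries.coeff_expand_of_not_dvd]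
      exact_mod_cast hk

lemma frobOne_formalMul (f : ℂ_[p]⟦X⟧) (h : ℤ → ℂ_[p]) :
    frobOne (formalMul (ofPowerSeries f) h) =
      formalMul (ofPowerSeries (f.expand p prime_ne_zero)) (frobOne h) := by
  have hp : (p : ℤ) ≠ 0 := by exact_mod_cast prime_ne_zero
  rw [← frobOne_ofPowerSeries]
  funext k
  by_cases hk : (p : ℤ) ∣ k
  · obtain ⟨m, rfl⟩ := hk
    rw [frobOne_mul, formalMul, formalMul,
      ← Function.Injective.tsum_eq (f := mulTerm _ (frobOne h) _) (mul_right_injective₀ hp)]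
    · refine tsum_congr fun d => ?_
      simp only [mulTerm, ← mul_sub, frobOne_mul]
    · intro d hd
      by_contra hd'
      refine hd ?_
      rw [mulTerm, frobOne_of_not_dvd, zero_mul]
      rintro ⟨m, rfl⟩
      exact hd' ⟨m, rfl⟩
  · rw [frobOne_of_not_dvd _ hk, formalMul]
    symm
    refine (tsum_congr fun d => ?_).trans tsum_zero
    by_cases hd : (p : ℤ) ∣ d
    · rw [mulTerm, frobOne_of_not_dvd _ (fun h => hk ((dvd_sub_left hd).1 h)), mul_zero]
    · rw [mulTerm, frobOne_of_not_dvd _ hd, zero_mul]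

/-! ### Norms of factorials and of the numbers `γ_j` -/

lemma norm_natCast_prime : ‖(p : ℂ_[p])‖ = (p : ℝ)⁻¹ := by
  rw [← map_natCast (algebraMap ℚ_[p] ℂ_[p]), norm_algebraMap', Padic.norm_p]

lemma one_lt_prime_cast : (1 : ℝ) < p := by exact_mod_cast (Fact.out : p.Prime).one_lt

lemma IsDworkZero.norm_pos {γ₀ : ℂ_[p]} (hγ₀ : IsDworkZero γ₀) : 0 < ‖γ₀‖ := by
  have := one_lt_prime_cast (p := p)
  rw [hγ₀.2]; positivity

lemma IsDworkZero.ne_zero {γ₀ : ℂ_[p]} (hγ₀ : IsDworkZero γ₀) : γ₀ ≠ 0 :=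
  norm_pos_iff.1 hγ₀.norm_pos

lemma IsDworkZero.norm_lt_one {γ₀ : ℂ_[p]} (hγ₀ : IsDworkZero γ₀) : ‖γ₀‖ < 1 := by
  have := one_lt_prime_cast (p := p)
  rw [hγ₀.2]
  refine Real.rpow_lt_one_of_one_lt_of_neg this (neg_neg_of_pos ?_)
  exact one_div_pos.2 (by linarith)

lemma IsDworkZero.norm_pow_sub_one {γ₀ : ℂ_[p]} (hγ₀ : IsDworkZero γ₀) :
    ‖γ₀‖ ^ (p - 1) = (p : ℝ)⁻¹ := by
  have := one_lt_prime_cast (p := p)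
  have h1 : ((p - 1 : ℕ) : ℝ) = p - 1 := by
    rw [Nat.cast_sub (Fact.out : p.Prime).one_le, Nat.cast_one]
  rw [hγ₀.2, ← Real.rpow_natCast, ← Real.rpow_mul (by linarith), h1, neg_mul,
    one_div, inv_mul_cancel₀ (by linarith), Real.rpow_neg_one]

lemma norm_natCast_eq (n : ℕ) (hn : n ≠ 0) :
    ‖(n : ℂ_[p])‖ = ((p : ℝ)⁻¹) ^ padicValNat p n := by
  rw [← map_natCast (algebraMap ℚ_[p] ℂ_[p]), norm_algebraMap',
    Padic.norm_eq_zpow_neg_valuation (by exact_mod_cast hn), Padic.valuation_natCast]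
  simp

/-- Legendre's formula, with the norm of `γ₀` as the unit: `|n!| = |γ₀| ^ (n - s_p(n))`. -/
lemma IsDworkZero.norm_factorial {γ₀ : ℂ_[p]} (hγ₀ : IsDworkZero γ₀) (n : ℕ) :
    ‖(n ! : ℂ_[p])‖ * ‖γ₀‖ ^ (p.digits n).sum = ‖γ₀‖ ^ n := by
  rw [norm_natCast_eq _ n.factorial_ne_zero, ← hγ₀.norm_pow_sub_one, ← pow_mul,
    sub_one_mul_padicValNat_factorial, ← pow_add, Nat.sub_add_cancel (Nat.digit_sum_le p n)]

lemma IsDworkZero.pow_le_norm_factorial {γ₀ : ℂ_[p]} (hγ₀ : IsDworkZero γ₀) (n : ℕ) :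
    ‖γ₀‖ ^ n ≤ ‖(n ! : ℂ_[p])‖ := by
  rw [← hγ₀.norm_factorial]
  exact mul_le_of_le_one_right (norm_nonneg _)
    (pow_le_one₀ (norm_nonneg _) hγ₀.norm_lt_one.le)

/-- The exponents of `|γ₀|` in the norms of the terms `γ₀ ^ p ^ i / p ^ i` do not decrease. -/
lemma pow_sub_mul_mono {q i j : ℕ} (hij : i ≤ j) :
    (q + 1) ^ i - (q : ℤ) * i ≤ (q + 1) ^ j - (q : ℤ) * j := by
  induction j, hij using Nat.le_induction with
  | base => exact le_rfl
  | succ j _ ih =>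
    refine ih.trans ?_
    have : (1 : ℤ) ≤ (q + 1) ^ j := one_le_pow₀ (by lia)
    push_cast
    rw [pow_succ]
    nlinarith [this, (Nat.cast_nonneg q : (0 : ℤ) ≤ q)]

lemma IsDworkZero.norm_term {γ₀ : ℂ_[p]} (hγ₀ : IsDworkZero γ₀) (i : ℕ) :
    ‖γ₀ ^ p ^ i / (p : ℂ_[p]) ^ i‖ =
      ‖γ₀‖ ^ (((p - 1 : ℕ) + 1) ^ i - ((p - 1 : ℕ) : ℤ) * i) := by
  have h1 : p - 1 + 1 = p := Nat.sub_add_cancel (Fact.out : p.Prime).one_le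
  have h2 : ((p - 1 : ℕ) + 1 : ℤ) = p := by exact_mod_cast h1
  rw [h2, norm_div, norm_pow, norm_pow, norm_natCast_prime, ← hγ₀.norm_pow_sub_one, ← pow_mul,
    zpow_sub₀ hγ₀.norm_pos.ne', ← Nat.cast_mul, ← Nat.cast_pow, zpow_natCast, zpow_natCast]

/-- As `γ₀` is a zero of `∑ t ^ p ^ i / p ^ i`, the partial sum `γ_j` is minus the remainder, so it
is as small as the first omitted term. -/
lemma IsDworkZero.norm_gammaSeq_le {γ₀ : ℂ_[p]} (hγ₀ : IsDworkZero γ₀) (j : ℕ) :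
    ‖gammaSeq γ₀ j‖ ≤
      ‖γ₀‖ ^ (((p - 1 : ℕ) + 1) ^ (j + 1) - ((p - 1 : ℕ) : ℤ) * (j + 1 : ℕ)) := by
  have h := hγ₀.1.summable.sum_add_tsum_nat_add (j + 1)
  rw [hγ₀.1.tsum_eq] at h
  rw [gammaSeq, eq_neg_of_add_eq_zero_left h, norm_neg]
  refine IsUltrametricDist.norm_tsum_le_of_forall_le_of_nonneg (by positivity) fun i => ?_
  rw [hγ₀.norm_term]
  exact zpow_le_zpow_right_of_le_one₀ hγ₀.norm_pos hγ₀.norm_lt_one.le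
    (pow_sub_mul_mono (Nat.le_add_left _ _))

lemma expFactor_eq (γ₀ : ℂ_[p]) (j : ℕ) :
    expFactor γ₀ j = (PowerSeries.rescale (gammaSeq γ₀ j) (PowerSeries.exp ℂ_[p])).expand (p ^ j)
      (pow_ne_zero j prime_ne_zero) := by
  have hX := PowerSeries.HasSubst.X_pow (R := ℂ_[p]) (pow_ne_zero j (prime_ne_zero (p := p)))
  rw [PowerSeries.expand_apply, PowerSeries.rescale_eq_subst,
    PowerSeries.subst_comp_subst_apply (PowerSeries.HasSubst.smul_X' _) hX,
    PowerSeries.subst_smul hX, PowerSeries.subst_X hX, expFactor, PowerSeries.smul_eq_C_mul]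

lemma coeff_rescale_exp (c : ℂ_[p]) (m : ℕ) :
    PowerSeries.coeff m (PowerSeries.rescale c (PowerSeries.exp ℂ_[p])) = c ^ m / (m ! : ℂ_[p]) := by
  rw [PowerSeries.coeff_rescale, PowerSeries.coeff_exp, map_div₀, map_one, map_natCast]
  ring

lemma IsDworkZero.norm_coeff_expFactor_le {γ₀ : ℂ_[p]} (hγ₀ : IsDworkZero γ₀) {j : ℕ}
    (hj : 1 ≤ j) (k : ℕ) : ‖PowerSeries.coeff k (expFactor γ₀ j)‖ ≤ √‖γ₀‖ ^ k := by
  have hg := hγ₀.norm_pos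
  have hr : 0 < √‖γ₀‖ := Real.sqrt_pos.2 hg
  have hr1 : √‖γ₀‖ ≤ 1 := Real.sqrt_le_one.2 hγ₀.norm_lt_one.le
  have hr2 : ‖γ₀‖ = √‖γ₀‖ ^ (2 : ℤ) := by
    rw [zpow_ofNat, Real.sq_sqrt hg.le]
  rw [expFactor_eq]
  by_cases hk : p ^ j ∣ k
  · obtain ⟨m, rfl⟩ := hk
    rw [PowerSeries.coeff_expand_mul, coeff_rescale_exp, norm_div, norm_pow, pow_mul]
    have h1 : p - 1 + 1 = p := Nat.sub_add_cancel (Fact.out : p.Prime).one_le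
    have h2 : ((p - 1 : ℕ) + 1 : ℤ) = p := by exact_mod_cast h1
    have h3 : (2 : ℤ) ≤ p := by exact_mod_cast (Fact.out : p.Prime).two_le
    refine (div_le_div_of_nonneg_left (by positivity) (by positivity)
      (hγ₀.pow_le_norm_factorial m)).trans ?_
    rw [← div_pow]
    refine pow_le_pow_left₀ (by positivity) ?_ m
    rw [div_le_iff₀ hg]
    refine (hγ₀.norm_gammaSeq_le j).trans ?_
    nth_rw 1 [hr2]
    nth_rw 3 [hr2]
    rw [← zpow_mul, ← zpow_natCast, ← zpow_add₀ hr.ne']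
    refine zpow_le_zpow_right_of_le_one₀ hr hr1 ?_
    have h4 := pow_sub_mul_mono (q := p - 1) hj
    have h5 : (2 : ℤ) ≤ p ^ j := h3.trans (le_self_pow₀ (by lia) (by lia))
    have h6 : ((p - 1 : ℕ) : ℤ) = p - 1 := by lia
    rw [h2, h6] at h4 ⊢
    push_cast at h4 ⊢
    rw [pow_one] at h4
    rw [pow_succ]
    nlinarith
  · rw [PowerSeries.coeff_expand_of_not_dvd _ _ _ hk, norm_zero]
    positivity

lemma norm_coeff_prod_le {ι : Type*} (s : Finset ι) {F : ι → ℂ_[p]⟦X⟧} {r : ℝ} (hr : 0 ≤ r)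
    (h : ∀ j ∈ s, ∀ i, ‖PowerSeries.coeff i (F j)‖ ≤ r ^ i) (i : ℕ) :
    ‖PowerSeries.coeff i (∏ j ∈ s, F j)‖ ≤ r ^ i := by
  classical
  induction s using Finset.induction_on generalizing i with
  | empty =>
    rw [Finset.prod_empty, PowerSeries.coeff_one]
    split_ifs with hi
    · simp [hi]
    · rw [norm_zero]; exact pow_nonneg hr i
  | insert a s ha ih =>
    rw [Finset.prod_insert ha]
    exact norm_coeff_mul_le hr (h a (Finset.mem_insert_self a s))
      (ih fun j hj => h j (Finset.mem_insert_of_mem hj)) i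

lemma IsDworkZero.overconvergent_thetaHatOne {γ₀ : ℂ_[p]} (hγ₀ : IsDworkZero γ₀) :
    Overconvergent (thetaHatOne γ₀) := by
  refine overconvergent_of_le (Real.sqrt_nonneg ‖γ₀‖) ?_ fun k => ?_
  · rw [Real.sqrt_lt' one_pos, one_pow]; exact hγ₀.norm_lt_one
  · rw [thetaHatOne, PowerSeries.coeff_mk]
    exact norm_coeff_prod_le _ (Real.sqrt_nonneg _)
      (fun j hj => hγ₀.norm_coeff_expFactor_le (Finset.mem_Icc.1 hj).1) k

lemma sum_digits_le {b : ℕ} (hb : 1 < b) (n : ℕ) :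
    (b.digits n).sum ≤ (b - 1) * (b.digits n).length := by
  rw [mul_comm, ← smul_eq_mul]
  exact List.sum_le_card_nsmul _ _ fun d hd => Nat.le_sub_one_of_lt (Nat.digits_lt_base hb hd)

lemma zetaCoeff_of_nonneg (γ₀ : ℂ_[p]) {k : ℤ} (hk : 0 ≤ k) : zetaCoeff γ₀ k = 0 :=
  if_neg hk.not_gt

lemma zetaCoeff_neg_succ (γ₀ : ℂ_[p]) (i : ℕ) :
    zetaCoeff γ₀ (-(i + 1 : ℕ)) = (-1) ^ i * (i ! : ℂ_[p]) * γ₀ ^ (-(i + 1 : ℕ) : ℤ) := by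
  have h : (-(-((i + 1 : ℕ) : ℤ)) - 1).toNat = i := by push_cast; simp
  rw [zetaCoeff, if_pos (by push_cast; lia), h]

/-- The coefficients `(-1) ^ i i! γ₀ ^ (-i - 1)` have norm `|γ₀| ^ (-s_p(i) - 1)`, which grows at most
linearly in `i`, because the digit sum `s_p(i)` is at most `p - 1` times the number of digits. -/
lemma IsDworkZero.norm_zetaCoeff_le {γ₀ : ℂ_[p]} (hγ₀ : IsDworkZero γ₀) (i : ℕ) :
    ‖zetaCoeff γ₀ (-(i + 1 : ℕ))‖ ≤ ‖γ₀‖⁻¹ * (p * (i + 1 : ℕ)) := by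
  have hg := hγ₀.norm_pos
  have hp := (Fact.out : p.Prime)
  have h1 : ‖(i ! : ℂ_[p])‖ * (‖γ₀‖ ^ i)⁻¹ = (‖γ₀‖ ^ (p.digits i).sum)⁻¹ := by
    rw [← hγ₀.norm_factorial i]
    have : ‖(i ! : ℂ_[p])‖ ≠ 0 := by
      rw [norm_ne_zero_iff]; exact_mod_cast i.factorial_ne_zero
    field_simp
  have h2 : (‖γ₀‖ ^ (p.digits i).sum)⁻¹ ≤ p * (i + 1 : ℕ) := by
    calc (‖γ₀‖ ^ (p.digits i).sum)⁻¹ ≤ (‖γ₀‖ ^ ((p - 1) * (p.digits i).length))⁻¹ := by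
          refine inv_anti₀ (by positivity) ?_
          exact pow_le_pow_of_le_one hg.le hγ₀.norm_lt_one.le (sum_digits_le hp.one_lt i)
      _ = ((p ^ (p.digits i).length : ℕ) : ℝ) := by
          rw [pow_mul, hγ₀.norm_pow_sub_one, inv_pow, inv_inv, Nat.cast_pow]
      _ ≤ ((p * (i + 1) : ℕ) : ℝ) := by
          refine Nat.cast_le.2 ?_
          rcases eq_or_ne i 0 with rfl | hi
          · simpa using hp.one_le
          · exact (Nat.base_pow_length_digits_le p i hp.one_lt hi).trans
              (Nat.mul_le_mul_left p (Nat.le_succ i))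
      _ = p * (i + 1 : ℕ) := by push_cast; rfl
  rw [zetaCoeff_neg_succ, norm_mul, norm_mul, norm_pow, norm_neg, norm_one, one_pow, one_mul,
    norm_zpow, zpow_neg, zpow_natCast, pow_succ, mul_inv, ← mul_assoc, h1, mul_comm]
  exact mul_le_mul_of_nonneg_left h2 (by positivity)

lemma IsDworkZero.subexponentialGrowth_zetaCoeff {γ₀ : ℂ_[p]} (hγ₀ : IsDworkZero γ₀) :
    SubexponentialGrowth (zetaCoeff γ₀) := by
  have hg := hγ₀.norm_pos
  filter_upwards [eventually_gt_lt_one zero_lt_one] with s hs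
  have hs0 : 0 < s := hs.1
  obtain ⟨C, hC⟩ := (tendsto_self_mul_const_pow_of_lt_one hs.1.le hs.2).bddAbove_range
  refine ⟨‖γ₀‖⁻¹ * (p * C), fun k => ?_⟩
  have hC' : ∀ n : ℕ, n * s ^ n ≤ C := fun n => hC ⟨n, rfl⟩
  have hC0 : 0 ≤ C := by simpa using hC' 0
  rcases lt_or_ge k 0 with hk | hk
  · obtain ⟨i, rfl⟩ : ∃ i : ℕ, k = -(i + 1 : ℕ) := ⟨(-k - 1).toNat, by push_cast; lia⟩
    refine (hγ₀.norm_zetaCoeff_le i).trans ?_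
    rw [zpow_neg, zpow_natCast, mul_assoc, mul_assoc]
    refine mul_le_mul_of_nonneg_left (mul_le_mul_of_nonneg_left ?_ (by positivity)) (by positivity)
    rw [← div_eq_mul_inv, le_div_iff₀ (by positivity)]
    exact hC' _
  · rw [zetaCoeff_of_nonneg γ₀ hk, norm_zero]; positivity

/-! ### Logarithmic derivatives and functional equations -/

/-- The Euler derivation `t d/dt`. -/
def euler (K : Type*) [Field K] : Derivation K K⟦X⟧ K⟦X⟧ :=
  (PowerSeries.X : K⟦X⟧) • PowerSeries.derivative K

section Euler

variable {K : Type*} [Field K]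

lemma euler_apply (f : K⟦X⟧) : euler K f = PowerSeries.X * PowerSeries.derivative K f := rfl

lemma coeff_euler (f : K⟦X⟧) (n : ℕ) :
    PowerSeries.coeff n (euler K f) = n * PowerSeries.coeff n f := by
  rw [euler_apply]
  cases n with
  | zero => simp
  | succ n =>
    rw [PowerSeries.coeff_succ_X_mul, PowerSeries.coeff_derivative, mul_comm]
    push_cast; rfl

lemma euler_mul {f g A B : K⟦X⟧} (hf : euler K f = A * f) (hg : euler K g = B * g) :
    euler K (f * g) = (A + B) * (f * g) := by
  rw [Derivation.leibniz, smul_eq_mul, smul_eq_mul, hf, hg]; ring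

lemma euler_pow {f A : K⟦X⟧} (hf : euler K f = A * f) (n : ℕ) :
    euler K (f ^ n) = (n * A) * f ^ n := by
  induction n with
  | zero => simp
  | succ n ih => rw [pow_succ, euler_mul ih hf]; push_cast; ring

lemma euler_prod {ι : Type*} (s : Finset ι) {f A : ι → K⟦X⟧}
    (hf : ∀ i, euler K (f i) = A i * f i) :
    euler K (∏ i ∈ s, f i) = (∑ i ∈ s, A i) * ∏ i ∈ s, f i := by
  classical
  induction s using Finset.induction_on with
  | empty => simp
  | insert a s ha ih =>
    rw [Finset.prod_insert ha, Finset.sum_insert ha, euler_mul (hf a) ih]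

lemma euler_inv {f A : K⟦X⟧} (hf : euler K f = A * f) (h0 : PowerSeries.constantCoeff f ≠ 0) :
    euler K f⁻¹ = -A * f⁻¹ := by
  have h1 := PowerSeries.mul_inv_cancel f h0
  have h2 : euler K (f * f⁻¹) = 0 := by rw [h1, Derivation.map_one_eq_zero]
  rw [Derivation.leibniz, smul_eq_mul, smul_eq_mul, hf] at h2
  linear_combination f⁻¹ * h2 - (euler K f⁻¹ + f⁻¹ * A) * h1

lemma euler_expand (f : K⟦X⟧) {q : ℕ} (hq : q ≠ 0) :
    euler K (f.expand q hq) = q * (euler K f).expand q hq := by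
  ext n
  rw [coeff_euler, ← map_natCast (PowerSeries.C (R := K)), PowerSeries.coeff_C_mul]
  by_cases hn : q ∣ n
  · obtain ⟨m, rfl⟩ := hn
    rw [PowerSeries.coeff_expand_mul, PowerSeries.coeff_expand_mul, coeff_euler]
    push_cast; ring
  · rw [PowerSeries.coeff_expand_of_not_dvd _ _ _ hn, PowerSeries.coeff_expand_of_not_dvd _ _ _ hn]
    simp

lemma euler_expand_of_eq {f A : K⟦X⟧} (hf : euler K f = A * f) {q : ℕ} (hq : q ≠ 0) :
    euler K (f.expand q hq) = (q * A.expand q hq) * f.expand q hq := by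
  rw [euler_expand, hf, map_mul, mul_assoc]

lemma euler_rescale {f A : K⟦X⟧} (hf : euler K f = A * f) (c : K) :
    euler K (PowerSeries.rescale c f) = PowerSeries.rescale c A * PowerSeries.rescale c f := by
  rw [← map_mul, ← hf]
  ext n
  rw [coeff_euler, PowerSeries.coeff_rescale, PowerSeries.coeff_rescale, coeff_euler]
  ring

lemma euler_exp [Algebra ℚ K] : euler K (PowerSeries.exp K) = PowerSeries.X * PowerSeries.exp K := by
  rw [euler_apply, PowerSeries.derivative_exp]

lemma euler_exp_subst [Algebra ℚ K] {g : K⟦X⟧} (hg : PowerSeries.constantCoeff g = 0) :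
    euler K ((PowerSeries.exp K).subst g) = euler K g * (PowerSeries.exp K).subst g := by
  rw [euler_apply, euler_apply,
    PowerSeries.derivative_subst (PowerSeries.HasSubst.of_constantCoeff_zero' hg),
    PowerSeries.derivative_exp]
  ring

lemma constantCoeff_exp_subst [Algebra ℚ K] {g : K⟦X⟧} (hg : PowerSeries.constantCoeff g = 0) :
    PowerSeries.constantCoeff ((PowerSeries.exp K).subst g) = 1 := by
  have hs := PowerSeries.HasSubst.of_constantCoeff_zero' hg
  have h1 : (1 : K⟦X⟧).subst g = (1 : K⟦X⟧) := by
    rw [← PowerSeries.coe_substAlgHom hs, map_one]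
  have h2 : (PowerSeries.exp K).subst g = (PowerSeries.exp K - 1).subst g + (1 : K⟦X⟧) := by
    rw [PowerSeries.subst_sub hs, h1, sub_add_cancel]
  have h3 : PowerSeries.constantCoeff ((PowerSeries.exp K - 1).subst g : K⟦X⟧) = 0 :=
    PowerSeries.constantCoeff_subst_eq_zero (a := g) hg (PowerSeries.exp K - 1) (by simp)
  rw [h2, map_add, h3, map_one, zero_add]

variable [CharZero K]

/-- A power series with constant term `1` is determined by its logarithmic derivative. -/
lemma eq_of_euler_eq {f g A : K⟦X⟧} (hf : euler K f = A * f) (hg : euler K g = A * g)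
    (hf0 : PowerSeries.constantCoeff f = 1) (hg0 : PowerSeries.constantCoeff g = 1) : f = g := by
  have h0 : PowerSeries.constantCoeff g ≠ 0 := by rw [hg0]; exact one_ne_zero
  have h : euler K (f * g⁻¹) = 0 := by
    rw [euler_mul hf (euler_inv hg h0)]; ring
  have h1 : f * g⁻¹ = 1 := by
    ext n
    rcases eq_or_ne n 0 with rfl | hn
    · simp [hf0, hg0]
    · have h2 := congrArg (PowerSeries.coeff n) h
      rw [coeff_euler, map_zero] at h2
      rw [(mul_eq_zero.1 h2).resolve_left (Nat.cast_ne_zero.2 hn), PowerSeries.coeff_one,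
        if_neg hn]
  calc f = f * g⁻¹ * g := by rw [mul_assoc, PowerSeries.inv_mul_cancel g h0, mul_one]
    _ = g := by rw [h1, one_mul]

end Euler

/-! ### Series in the powers `t ^ p ^ i` -/

/-- The series `∑_i c_i t ^ p ^ i`. -/
def lacunary {K : Type*} [Field K] (p : ℕ) (c : ℕ → K) : K⟦X⟧ :=
  PowerSeries.mk fun k => if p ^ Nat.log p k = k then c (Nat.log p k) else 0

section Lacunary

variable {K : Type*} [Field K]

lemma coeff_lacunary_pow (c : ℕ → K) (i : ℕ) :
    PowerSeries.coeff (p ^ i) (lacunary p c) = c i := by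
  have : Nat.log p (p ^ i) = i := Nat.log_pow (Fact.out : p.Prime).one_lt i
  simp [lacunary, this]

lemma coeff_lacunary_of_forall_ne {p : ℕ} (c : ℕ → K) {k : ℕ} (hk : ∀ i, k ≠ p ^ i) :
    PowerSeries.coeff k (lacunary p c) = 0 := by
  rw [lacunary, PowerSeries.coeff_mk, if_neg (fun h => hk _ h.symm)]

lemma eq_lacunary_iff {f : K⟦X⟧} {c : ℕ → K} (h1 : ∀ i, PowerSeries.coeff (p ^ i) f = c i)
    (h2 : ∀ k, (∀ i, k ≠ p ^ i) → PowerSeries.coeff k f = 0) : f = lacunary p c := by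
  ext k
  by_cases hk : ∃ i, k = p ^ i
  · obtain ⟨i, rfl⟩ := hk
    rw [coeff_lacunary_pow, h1]
  · rw [not_exists] at hk
    rw [coeff_lacunary_of_forall_ne c hk, h2 k hk]

lemma lacunary_add (c d : ℕ → K) : lacunary p c + lacunary p d = lacunary p (fun i => c i + d i) :=
  eq_lacunary_iff (fun i => by rw [map_add, coeff_lacunary_pow, coeff_lacunary_pow])
    fun k hk => by
      rw [map_add, coeff_lacunary_of_forall_ne c hk, coeff_lacunary_of_forall_ne d hk, add_zero]

lemma lacunary_neg (c : ℕ → K) : -lacunary p c = lacunary p (fun i => -c i) :=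
  eq_lacunary_iff (fun i => by rw [map_neg, coeff_lacunary_pow])
    fun k hk => by rw [map_neg, coeff_lacunary_of_forall_ne c hk, neg_zero]

lemma natCast_mul_lacunary (n : ℕ) (c : ℕ → K) :
    (n : K⟦X⟧) * lacunary p c = lacunary p (fun i => n * c i) := by
  rw [← map_natCast (PowerSeries.C (R := K))]
  exact eq_lacunary_iff (fun i => by rw [PowerSeries.coeff_C_mul, coeff_lacunary_pow])
    fun k hk => by rw [PowerSeries.coeff_C_mul, coeff_lacunary_of_forall_ne c hk, mul_zero]

lemma rescale_lacunary (x : K) (c : ℕ → K) :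
    PowerSeries.rescale x (lacunary p c) = lacunary p (fun i => x ^ p ^ i * c i) :=
  eq_lacunary_iff (fun i => by rw [PowerSeries.coeff_rescale, coeff_lacunary_pow])
    fun k hk => by rw [PowerSeries.coeff_rescale, coeff_lacunary_of_forall_ne c hk, mul_zero]

lemma euler_lacunary (c : ℕ → K) : euler K (lacunary p c) = lacunary p (fun i => p ^ i * c i) :=
  eq_lacunary_iff (fun i => by rw [coeff_euler, coeff_lacunary_pow, Nat.cast_pow])
    fun k hk => by rw [coeff_euler, coeff_lacunary_of_forall_ne c hk, mul_zero]

lemma expand_lacunary (c : ℕ → K) : (lacunary p c).expand p prime_ne_zero =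
    lacunary p (fun i => if i = 0 then 0 else c (i - 1)) := by
  have hp := (Fact.out : p.Prime)
  refine eq_lacunary_iff (fun i => ?_) fun k hk => ?_
  · cases i with
    | zero =>
      rw [pow_zero, PowerSeries.coeff_expand_of_not_dvd _ _ _ (by simpa using hp.one_lt.ne')]
      simp
    | succ i => rw [pow_succ', PowerSeries.coeff_expand_mul, coeff_lacunary_pow]; simp
  · by_cases hd : p ∣ k
    · obtain ⟨m, rfl⟩ := hd
      rw [PowerSeries.coeff_expand_mul, coeff_lacunary_of_forall_ne]
      rintro i rfl
      exact hk (i + 1) (pow_succ' p i).symm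
    · rw [PowerSeries.coeff_expand_of_not_dvd _ _ _ hd]

lemma constantCoeff_lacunary (c : ℕ → K) : PowerSeries.constantCoeff (lacunary p c) = 0 := by
  rw [← PowerSeries.coeff_zero_eq_constantCoeff_apply]
  exact coeff_lacunary_of_forall_ne c fun i => (pow_ne_zero i prime_ne_zero).symm

lemma C_mul_X_pow_eq_lacunary (x : K) (j : ℕ) :
    PowerSeries.C x * PowerSeries.X ^ p ^ j = lacunary p (fun i => if i = j then x else 0) := by
  refine eq_lacunary_iff (fun i => ?_) fun k hk => ?_
  · rw [PowerSeries.coeff_C_mul, PowerSeries.coeff_X_pow]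
    simp [Nat.pow_right_inj (Fact.out : p.Prime).one_lt]
  · rw [PowerSeries.coeff_C_mul, PowerSeries.coeff_X_pow, if_neg (hk j), mul_zero]

end Lacunary

lemma mk_dworkLogCoeff :
    PowerSeries.mk (dworkLogCoeff p) = lacunary p (fun i => ((p : ℂ_[p]) ^ i)⁻¹) := by
  refine eq_lacunary_iff (fun i => ?_) fun k hk => ?_
  · rw [PowerSeries.coeff_mk, dworkLogCoeff, if_pos ⟨i, rfl⟩, Nat.cast_pow]
  · rw [PowerSeries.coeff_mk, dworkLogCoeff, if_neg (fun ⟨i, hi⟩ => hk i hi)]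

lemma natCast_prime_ne_zero : (p : ℂ_[p]) ≠ 0 := Nat.cast_ne_zero.2 prime_ne_zero

lemma euler_artinHasse :
    euler ℂ_[p] (artinHasse p) = lacunary p (fun _ => 1) * artinHasse p := by
  rw [artinHasse, mk_dworkLogCoeff, euler_exp_subst (constantCoeff_lacunary _), euler_lacunary]
  congr 3
  funext i
  exact mul_inv_cancel₀ (pow_ne_zero i natCast_prime_ne_zero)

lemma constantCoeff_artinHasse : PowerSeries.constantCoeff (artinHasse p) = 1 := by
  rw [artinHasse, mk_dworkLogCoeff]
  exact constantCoeff_exp_subst (constantCoeff_lacunary _)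

lemma constantCoeff_rescale (f : ℂ_[p]⟦X⟧) (c : ℂ_[p]) :
    PowerSeries.constantCoeff (PowerSeries.rescale c f) = PowerSeries.constantCoeff f := by
  rw [← PowerSeries.coeff_zero_eq_constantCoeff_apply, PowerSeries.coeff_rescale]; simp

lemma euler_theta (γ₀ : ℂ_[p]) :
    euler ℂ_[p] (theta γ₀) = lacunary p (fun i => γ₀ ^ p ^ i) * theta γ₀ := by
  rw [theta, euler_rescale euler_artinHasse, rescale_lacunary]
  simp

lemma constantCoeff_theta (γ₀ : ℂ_[p]) : PowerSeries.constantCoeff (theta γ₀) = 1 := by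
  rw [theta, constantCoeff_rescale, constantCoeff_artinHasse]

lemma euler_rescale_exp (c : ℂ_[p]) : euler ℂ_[p] (PowerSeries.rescale c (PowerSeries.exp ℂ_[p])) =
    (PowerSeries.C c * PowerSeries.X) * PowerSeries.rescale c (PowerSeries.exp ℂ_[p]) := by
  rw [euler_rescale euler_exp, PowerSeries.rescale_X]

lemma euler_expFactor (γ₀ : ℂ_[p]) (j : ℕ) : euler ℂ_[p] (expFactor γ₀ j) =
    (PowerSeries.C (p ^ j * gammaSeq γ₀ j) * PowerSeries.X ^ p ^ j) * expFactor γ₀ j := by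
  rw [expFactor, C_mul_X_pow_eq_lacunary, C_mul_X_pow_eq_lacunary,
    euler_exp_subst (constantCoeff_lacunary _), euler_lacunary]
  congr 3
  funext i
  split_ifs with h
  · rw [h]
  · rw [mul_zero]

/-- The coefficients of `θ̂₁` are those of every sufficiently long partial product. -/
lemma coeff_thetaHatOne (γ₀ : ℂ_[p]) {k K : ℕ} (hk : k ≤ K) :
    PowerSeries.coeff k (thetaHatOne γ₀) =
      PowerSeries.coeff k (∏ j ∈ Finset.Icc 1 K, expFactor γ₀ j) := by
  induction K, hk using Nat.le_induction with
  | base => rw [thetaHatOne, PowerSeries.coeff_mk]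
  | succ K hK ih =>
    rw [ih, Finset.prod_Icc_succ_top (Nat.le_add_left 1 K), PowerSeries.coeff_mul,
      Finset.sum_eq_single (k, 0)]
    · rw [expFactor_eq]
      simp [constantCoeff_rescale]
    · rintro ⟨a, b⟩ hab hne
      rw [Finset.HasAntidiagonal.mem_antidiagonal] at hab
      have hab' : a + b = k := hab
      have hb : b ≠ 0 := fun hb => hne (by rw [hb] at hab' ⊢; rw [← hab', add_zero])
      rw [expFactor_eq, PowerSeries.coeff_expand_of_not_dvd, mul_zero]
      intro hd
      have h1 := Nat.le_of_dvd (Nat.pos_of_ne_zero hb) hd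
      have h2 := Nat.lt_pow_self (n := K + 1) (Fact.out : p.Prime).one_lt
      lia
    · intro h
      exact absurd (Finset.HasAntidiagonal.mem_antidiagonal.2 (add_zero k)) h

lemma constantCoeff_thetaHatOne (γ₀ : ℂ_[p]) : PowerSeries.constantCoeff (thetaHatOne γ₀) = 1 := by
  rw [← PowerSeries.coeff_zero_eq_constantCoeff_apply, coeff_thetaHatOne γ₀ le_rfl]
  simp

lemma euler_thetaHatOne (γ₀ : ℂ_[p]) : euler ℂ_[p] (thetaHatOne γ₀) =
    lacunary p (fun j => if j = 0 then 0 else p ^ j * gammaSeq γ₀ j) * thetaHatOne γ₀ := by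
  ext k
  rw [coeff_euler, coeff_thetaHatOne γ₀ le_rfl, ← coeff_euler, euler_prod _ (euler_expFactor γ₀),
    PowerSeries.coeff_mul, PowerSeries.coeff_mul]
  refine Finset.sum_congr rfl ?_
  rintro ⟨a, b⟩ hab
  rw [Finset.HasAntidiagonal.mem_antidiagonal] at hab
  have hab' : a + b = k := hab
  rw [coeff_thetaHatOne γ₀ (by lia : b ≤ k), map_sum]
  congr 1
  simp only [PowerSeries.coeff_C_mul, PowerSeries.coeff_X_pow]
  by_cases ha : ∃ i, a = p ^ i
  · obtain ⟨i, rfl⟩ := ha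
    have hi : i < p ^ i := Nat.lt_pow_self (Fact.out : p.Prime).one_lt
    simp only [coeff_lacunary_pow, Nat.pow_right_inj (Fact.out : p.Prime).one_lt, mul_ite, mul_one,
      mul_zero, Finset.sum_ite_eq, Finset.mem_Icc]
    by_cases h0 : i = 0
    · simp [h0]
    · rw [if_pos ⟨by lia, by lia⟩, if_neg h0]
  · rw [not_exists] at ha
    rw [coeff_lacunary_of_forall_ne _ ha]
    exact Finset.sum_eq_zero fun i _ => by rw [if_neg (ha i), mul_zero]

/-- The series `θ(t) θ̂₁(t ^ p) / θ̂₁(t)`, which is Dwork's splitting function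
`exp(γ₀ (t - t ^ p))`. -/
def splitting (γ₀ : ℂ_[p]) : ℂ_[p]⟦X⟧ :=
  theta γ₀ * (thetaHatOne γ₀).expand p prime_ne_zero * (thetaHatOne γ₀)⁻¹

lemma constantCoeff_thetaHatOne_ne_zero (γ₀ : ℂ_[p]) :
    PowerSeries.constantCoeff (thetaHatOne γ₀) ≠ 0 := by
  rw [constantCoeff_thetaHatOne]; exact one_ne_zero

lemma constantCoeff_splitting (γ₀ : ℂ_[p]) : PowerSeries.constantCoeff (splitting γ₀) = 1 := by
  simp [splitting, constantCoeff_theta, constantCoeff_thetaHatOne]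

lemma splitting_mul_thetaHatOne (γ₀ : ℂ_[p]) :
    splitting γ₀ * thetaHatOne γ₀ = theta γ₀ * (thetaHatOne γ₀).expand p prime_ne_zero := by
  rw [splitting, mul_assoc, PowerSeries.inv_mul_cancel _ (constantCoeff_thetaHatOne_ne_zero γ₀),
    mul_one]

lemma gammaSeq_succ (γ₀ : ℂ_[p]) (j : ℕ) :
    gammaSeq γ₀ (j + 1) = gammaSeq γ₀ j + γ₀ ^ p ^ (j + 1) / (p : ℂ_[p]) ^ (j + 1) := by
  rw [gammaSeq, Finset.sum_range_succ, ← gammaSeq]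

lemma gammaSeq_zero (γ₀ : ℂ_[p]) : gammaSeq γ₀ 0 = γ₀ := by simp [gammaSeq]

lemma euler_splitting (γ₀ : ℂ_[p]) : euler ℂ_[p] (splitting γ₀) =
    (PowerSeries.C γ₀ * PowerSeries.X + PowerSeries.C (-(p * γ₀)) * PowerSeries.X ^ p) *
      splitting γ₀ := by
  have hp : (p : ℂ_[p]) ≠ 0 := natCast_prime_ne_zero
  rw [splitting, euler_mul (euler_mul (euler_theta γ₀) (euler_expand_of_eq (euler_thetaHatOne γ₀) _))
    (euler_inv (euler_thetaHatOne γ₀) (constantCoeff_thetaHatOne_ne_zero γ₀))]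
  congr 1
  have h0 := C_mul_X_pow_eq_lacunary (p := p) γ₀ 0
  have h1 := C_mul_X_pow_eq_lacunary (p := p) (-(p * γ₀)) 1
  rw [pow_zero, pow_one] at h0
  rw [pow_one] at h1
  rw [h0, h1, expand_lacunary, natCast_mul_lacunary, lacunary_neg, lacunary_add, lacunary_add,
    lacunary_add]
  congr 1
  funext j
  rcases j with _ | _ | j
  · simp
  · have := gammaSeq_succ γ₀ 0
    rw [gammaSeq_zero] at this
    simp only [zero_add, pow_one] at this ⊢
    simp only [this]
    field_simp
    simp
  · have := gammaSeq_succ γ₀ (j + 1)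
    simp only [Nat.add_sub_cancel, this]
    field_simp
    simp
    ring

lemma splitting_mul_expand_exp (γ₀ : ℂ_[p]) :
    splitting γ₀ * (PowerSeries.rescale γ₀ (PowerSeries.exp ℂ_[p])).expand p prime_ne_zero =
      PowerSeries.rescale γ₀ (PowerSeries.exp ℂ_[p]) := by
  refine eq_of_euler_eq (A := PowerSeries.C γ₀ * PowerSeries.X) ?_ (euler_rescale_exp γ₀) ?_ ?_
  · rw [euler_mul (euler_splitting γ₀) (euler_expand_of_eq (euler_rescale_exp γ₀) _)]
    congr 1
    rw [map_mul, PowerSeries.expand_C, PowerSeries.expand_X, map_neg, map_mul, map_natCast]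
    ring
  · simp [constantCoeff_splitting, constantCoeff_rescale]
  · simp [constantCoeff_rescale]

/-- The functional equation `θ(t) θ̂(t ^ p) = θ̂(t)` of `θ̂(t) = exp(γ₀ t) θ̂₁(t)`. -/
lemma theta_mul_expand (γ₀ : ℂ_[p]) :
    theta γ₀ * (PowerSeries.rescale γ₀ (PowerSeries.exp ℂ_[p]) * thetaHatOne γ₀).expand p
      prime_ne_zero = PowerSeries.rescale γ₀ (PowerSeries.exp ℂ_[p]) * thetaHatOne γ₀ := by
  rw [map_mul]
  linear_combination thetaHatOne γ₀ * splitting_mul_expand_exp γ₀ -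
    (PowerSeries.rescale γ₀ (PowerSeries.exp ℂ_[p])).expand p prime_ne_zero *
      splitting_mul_thetaHatOne γ₀

/-! ### Integrality of the Artin-Hasse series -/

/-- A polynomial over `ℤ_p` satisfies `Q(t) ^ p ≡ Q(t ^ p)` modulo `p`. -/
lemma C_prime_dvd_pow_sub_expand (Q : Polynomial ℤ_[p]) :
    Polynomial.C (p : ℤ_[p]) ∣ Q ^ p - Polynomial.expand ℤ_[p] p Q := by
  rw [Polynomial.C_dvd_iff_dvd_coeff]
  intro i
  have h : Polynomial.map (PadicInt.toZMod (p := p)) (Q ^ p - Polynomial.expand ℤ_[p] p Q) = 0 := by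
    rw [Polynomial.map_sub, Polynomial.map_pow, Polynomial.map_expand, ZMod.expand_card, sub_self]
  have h1 := congrArg (fun q => Polynomial.coeff q i) h
  simp only [Polynomial.coeff_map, Polynomial.coeff_zero] at h1
  rw [← RingHom.mem_ker, PadicInt.ker_toZMod, PadicInt.maximalIdeal_eq_span_p,
    Ideal.mem_span_singleton] at h1
  exact h1

lemma exists_padicInt_eq {x : ℚ_[p]} (hx : ‖x‖ ≤ 1) :
    ∃ z : ℤ_[p], PadicInt.Coe.ringHom (p := p) z = x := ⟨⟨x, hx⟩, rfl⟩

/-- Dwork's criterion: a power series over `ℚ_p` with constant term `1` is integral as soon as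
`F(t ^ p) / F(t) ^ p` lies in `1 + p t ℤ_p⟦t⟧`. The coefficients are treated one after the other:
once those below `n` are known to be integral, comparing the coefficients of `t ^ n` shows that
`p` times the `n`-th one is divisible by `p`. -/
lemma norm_coeff_le_one_of_expand_eq {F : ℚ_[p]⟦X⟧} (h0 : PowerSeries.constantCoeff F = 1)
    {G : ℤ_[p]⟦X⟧} (hG0 : PowerSeries.constantCoeff G = 0)
    (hF : F.expand p prime_ne_zero =
      F ^ p * (1 + p * PowerSeries.map (PadicInt.Coe.ringHom (p := p)) G)) (n : ℕ) :
    ‖PowerSeries.coeff n F‖ ≤ 1 := by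
  have hp := (Fact.out : p.Prime)
  induction n using Nat.strong_induction_on with
  | _ n ih =>
  rcases Nat.eq_zero_or_pos n with rfl | hn
  · simp [h0]
  set ι := PadicInt.Coe.ringHom (p := p)
  -- the part of `F` below degree `n`, with coefficients in `ℤ_p`
  choose z hz using fun i : Fin n => exists_padicInt_eq (ih i i.2)
  let Q : Polynomial ℤ_[p] := ∑ i : Fin n, Polynomial.monomial i (z i)
  set A : ℚ_[p]⟦X⟧ := PowerSeries.map ι (Q : ℤ_[p]⟦X⟧) with hA
  have hQ (m : ℕ) : PowerSeries.coeff m A = if m < n then PowerSeries.coeff m F else 0 := by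
    rw [hA, PowerSeries.coeff_map, Polynomial.coeff_coe, Polynomial.finsetSum_coeff, map_sum]
    simp only [Polynomial.coeff_monomial]
    split_ifs with hm
    · rw [Finset.sum_eq_single ⟨m, hm⟩]
      · rw [if_pos rfl]; exact hz ⟨m, hm⟩
      · intro b _ hb
        rw [if_neg (fun h => hb (Fin.ext h)), map_zero]
      · simp
    · exact Finset.sum_eq_zero fun b _ => by rw [if_neg (by lia), map_zero]
  obtain ⟨S, hS⟩ : (PowerSeries.X : ℚ_[p]⟦X⟧) ^ n ∣ F - A := by
    rw [PowerSeries.X_pow_dvd_iff]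
    intro m hm
    rw [map_sub, hQ, if_pos hm, sub_self]
  have hFA : F = A + PowerSeries.X ^ n * S := by rw [← hS]; ring
  have hS0 : PowerSeries.coeff n F = PowerSeries.constantCoeff S := by
    rw [hFA, map_add, hQ, if_neg (lt_irrefl n), zero_add,
      ← PowerSeries.coeff_zero_eq_constantCoeff_apply]
    simpa using PowerSeries.coeff_X_pow_mul S n 0
  have hA0 : PowerSeries.constantCoeff A = 1 := by
    rw [← PowerSeries.coeff_zero_eq_constantCoeff_apply, hQ, if_pos hn,
      PowerSeries.coeff_zero_eq_constantCoeff_apply, h0]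
  have hcoeff (T : ℚ_[p]⟦X⟧) :
      PowerSeries.coeff n (PowerSeries.X ^ n * T) = PowerSeries.constantCoeff T := by
    simpa using PowerSeries.coeff_X_pow_mul T n 0
  obtain ⟨R, hR⟩ := C_prime_dvd_pow_sub_expand Q
  obtain ⟨k, hk⟩ := Polynomial.powAddExpansion A (PowerSeries.X ^ n * S) p
  rw [← hFA] at hk
  have hX : (0 : ℚ_[p]) ^ n = 0 := zero_pow hn.ne'
  have hFp : PowerSeries.coeff n (F ^ p) =
      PowerSeries.coeff n (A ^ p) + p * PowerSeries.coeff n F := by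
    have e : F ^ p = A ^ p + PowerSeries.X ^ n *
        ((p : ℚ_[p]⟦X⟧) * A ^ (p - 1) * S + k * PowerSeries.X ^ n * S ^ 2) := by
      rw [hk]; ring
    rw [e, map_add, hcoeff, hS0]
    simp [hA0, hX]
  have hFpG : PowerSeries.coeff n (F ^ p * PowerSeries.map ι G) =
      PowerSeries.coeff n (A ^ p * PowerSeries.map ι G) := by
    have e : F ^ p * PowerSeries.map ι G = A ^ p * PowerSeries.map ι G + PowerSeries.X ^ n *
        (((p : ℚ_[p]⟦X⟧) * A ^ (p - 1) * S + k * PowerSeries.X ^ n * S ^ 2) * PowerSeries.map ι G) := by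
      rw [hk]; ring
    have hG1 : PowerSeries.constantCoeff (PowerSeries.map ι G) = 0 := by
      rw [← PowerSeries.coeff_zero_eq_constantCoeff_apply, PowerSeries.coeff_map,
        PowerSeries.coeff_zero_eq_constantCoeff_apply, hG0, map_zero]
    rw [e, map_add, hcoeff, RingHom.map_mul, hG1, mul_zero, add_zero]
  have hexp : PowerSeries.coeff n (F.expand p prime_ne_zero) =
      PowerSeries.coeff n (A.expand p prime_ne_zero) := by
    by_cases hd : p ∣ n
    · obtain ⟨m, rfl⟩ := hd
      have hm : m < p * m :=
        lt_mul_left (Nat.pos_of_mul_pos_left hn) hp.one_lt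
      rw [PowerSeries.coeff_expand_mul, PowerSeries.coeff_expand_mul, hQ, if_pos hm]
    · rw [PowerSeries.coeff_expand_of_not_dvd _ _ _ hd,
        PowerSeries.coeff_expand_of_not_dvd _ _ _ hd]
  have hApR : PowerSeries.coeff n (A ^ p) = PowerSeries.coeff n (A.expand p prime_ne_zero) +
      p * ι (R.coeff n) := by
    have e1 : A ^ p = PowerSeries.map ι ((Q ^ p : Polynomial ℤ_[p]) : ℤ_[p]⟦X⟧) := by
      rw [hA, Polynomial.coe_pow, map_pow]
    have e2 : PowerSeries.coeff n (A.expand p prime_ne_zero) =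
        ι ((Polynomial.expand ℤ_[p] p Q).coeff n) := by
      rw [PowerSeries.coeff_expand, Polynomial.coeff_expand hp.pos]
      split_ifs
      · rw [hA, PowerSeries.coeff_map, Polynomial.coeff_coe]
      · rw [map_zero]
    have e3 := congrArg (fun q => Polynomial.coeff q n) hR
    simp only [Polynomial.coeff_sub, Polynomial.coeff_C_mul] at e3
    rw [e1, e2, PowerSeries.coeff_map, Polynomial.coeff_coe, sub_eq_iff_eq_add.1 e3, map_add,
      map_mul, map_natCast]
    ring
  have hAG : PowerSeries.coeff n (A ^ p * PowerSeries.map ι G) =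
      ι (PowerSeries.coeff n ((Q : ℤ_[p]⟦X⟧) ^ p * G)) := by
    rw [hA, ← map_pow, ← map_mul, PowerSeries.coeff_map]
  have hmain := congrArg (PowerSeries.coeff n) hF
  rw [hexp, mul_add, mul_one, map_add, hFp, hApR, mul_left_comm,
    ← map_natCast (PowerSeries.C (R := ℚ_[p])), PowerSeries.coeff_C_mul, hFpG, hAG] at hmain
  have hp0 : (p : ℚ_[p]) ≠ 0 := Nat.cast_ne_zero.2 hp.ne_zero
  have hfin : PowerSeries.coeff n F =
      ι (-(R.coeff n + PowerSeries.coeff n ((Q : ℤ_[p]⟦X⟧) ^ p * G))) := by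
    rw [map_neg, map_add]
    refine mul_left_cancel₀ hp0 ?_
    linear_combination -hmain
  rw [hfin]
  exact PadicInt.norm_le_one _

/-- The Artin-Hasse series over `ℚ_p`. -/
def artinHasseRat (p : ℕ) [Fact p.Prime] : ℚ_[p]⟦X⟧ :=
  (PowerSeries.exp ℚ_[p]).subst (lacunary p fun i => ((p : ℚ_[p]) ^ i)⁻¹)

lemma map_artinHasseRat :
    PowerSeries.map (algebraMap ℚ_[p] ℂ_[p]) (artinHasseRat p) = artinHasse p := by
  have hs := PowerSeries.HasSubst.of_constantCoeff_zero'
    (constantCoeff_lacunary (p := p) fun i => ((p : ℚ_[p]) ^ i)⁻¹)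
  rw [artinHasseRat, artinHasse, mk_dworkLogCoeff]
  refine (PowerSeries.map_subst hs (h := algebraMap ℚ_[p] ℂ_[p]) _).trans ?_
  rw [PowerSeries.map_exp]
  congr 1
  refine eq_lacunary_iff (fun i => ?_) fun k hk => ?_
  · refine (PowerSeries.coeff_map _ _ _).trans ?_
    rw [coeff_lacunary_pow, map_inv₀, map_pow, map_natCast]
  · refine (PowerSeries.coeff_map _ _ _).trans ?_
    rw [coeff_lacunary_of_forall_ne _ hk, map_zero]

lemma euler_artinHasseRat :
    euler ℚ_[p] (artinHasseRat p) = lacunary p (fun _ => 1) * artinHasseRat p := by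
  have hp : (p : ℚ_[p]) ≠ 0 := Nat.cast_ne_zero.2 prime_ne_zero
  rw [artinHasseRat, euler_exp_subst (constantCoeff_lacunary _), euler_lacunary]
  congr 3
  funext i
  exact mul_inv_cancel₀ (pow_ne_zero i hp)

/-- `p ^ n / n!` is divisible by `p` for `n ≥ 1`. -/
lemma norm_prime_pow_div_factorial_le {n : ℕ} :
    ‖(-(p : ℚ_[p])) ^ (n + 1) / ((n + 1)! : ℚ_[p]) / p‖ ≤ 1 := by
  have hp := (Fact.out : p.Prime)
  have hv : padicValNat p (n + 1)! ≤ n := by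
    have h := sub_one_mul_padicValNat_factorial_lt_of_ne_zero (p := p) (Nat.succ_ne_zero n)
    have := Nat.le_mul_of_pos_left (padicValNat p (n + 1)!) (Nat.sub_pos_of_lt hp.one_lt)
    simp only [Nat.succ_eq_add_one] at h
    lia
  have hfac : ‖((n + 1)! : ℚ_[p])‖ = ((p : ℝ)⁻¹) ^ padicValNat p (n + 1)! := by
    rw [Padic.norm_eq_zpow_neg_valuation (by exact_mod_cast (n + 1).factorial_ne_zero),
      Padic.valuation_natCast]
    simp
  have hp0 : (0 : ℝ) < (p : ℝ)⁻¹ := by have := one_lt_prime_cast (p := p); positivity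
  rw [norm_div, norm_div, norm_pow, norm_neg, Padic.norm_p, hfac, div_div, ← pow_succ]
  refine div_le_one_of_le₀ (pow_le_pow_of_le_one hp0.le ?_ (by lia)) (by positivity)
  exact inv_le_one_of_one_le₀ (one_lt_prime_cast (p := p)).le

/-- The Artin-Hasse series has integral coefficients. -/
lemma norm_coeff_artinHasse_le_one (n : ℕ) : ‖PowerSeries.coeff n (artinHasse p)‖ ≤ 1 := by
  have hp : (p : ℚ_[p]) ≠ 0 := Nat.cast_ne_zero.2 prime_ne_zero
  rw [← map_artinHasseRat, PowerSeries.coeff_map, norm_algebraMap']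
  -- `1 + p G = exp(-p t)`
  choose c hc using fun n : ℕ =>
    exists_padicInt_eq (norm_prime_pow_div_factorial_le (p := p) (n := n))
  let G : ℤ_[p]⟦X⟧ := PowerSeries.X * PowerSeries.mk c
  have hG : 1 + (p : ℚ_[p]⟦X⟧) * PowerSeries.map (PadicInt.Coe.ringHom (p := p)) G =
      PowerSeries.rescale (-(p : ℚ_[p])) (PowerSeries.exp ℚ_[p]) := by
    ext n
    rw [map_add, ← map_natCast (PowerSeries.C (R := ℚ_[p])), PowerSeries.coeff_C_mul,
      PowerSeries.coeff_map, PowerSeries.coeff_rescale, PowerSeries.coeff_exp, PowerSeries.coeff_one]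
    cases n with
    | zero => simp [G]
    | succ n =>
      rw [PowerSeries.coeff_succ_X_mul, PowerSeries.coeff_mk, hc, if_neg (Nat.succ_ne_zero n),
        zero_add, map_div₀, map_one, map_natCast]
      field_simp
  refine norm_coeff_le_one_of_expand_eq (F := artinHasseRat p)
    (constantCoeff_exp_subst (constantCoeff_lacunary _)) (G := G) (by simp [G]) ?_ n
  rw [hG]
  have e0 : PowerSeries.constantCoeff (artinHasseRat p) = 1 :=
    constantCoeff_exp_subst (constantCoeff_lacunary _)
  refine eq_of_euler_eq (euler_expand_of_eq euler_artinHasseRat _) ?_ ?_ ?_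
  · rw [euler_mul (euler_pow euler_artinHasseRat p) (euler_rescale euler_exp _)]
    congr 1
    have h1 := C_mul_X_pow_eq_lacunary (p := p) (-(p : ℚ_[p])) 0
    rw [pow_zero, pow_one] at h1
    rw [PowerSeries.rescale_X, h1, expand_lacunary, natCast_mul_lacunary, natCast_mul_lacunary,
      lacunary_add]
    congr 1
    funext i
    split_ifs <;> simp
  · simp [e0]
  · rw [map_mul, map_pow, e0, ← PowerSeries.coeff_zero_eq_constantCoeff_apply,
      PowerSeries.coeff_rescale]
    simp

lemma IsDworkZero.overconvergent_theta {γ₀ : ℂ_[p]} (hγ₀ : IsDworkZero γ₀) :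
    Overconvergent (theta γ₀) := by
  refine overconvergent_of_le (norm_nonneg γ₀) hγ₀.norm_lt_one fun k => ?_
  rw [theta, PowerSeries.coeff_rescale, norm_mul, norm_pow]
  exact mul_le_of_le_one_right (by positivity) (norm_coeff_artinHasse_le_one k)

lemma IsDworkZero.overconvergent_splitting {γ₀ : ℂ_[p]} (hγ₀ : IsDworkZero γ₀) :
    Overconvergent (splitting γ₀) :=
  (hγ₀.overconvergent_theta.mul (hγ₀.overconvergent_thetaHatOne.expand _)).mul
    (hγ₀.overconvergent_thetaHatOne.inv (constantCoeff_thetaHatOne γ₀))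

/-! ### The Frobenius relation for `ζ(γ₀ t) θ̂₁(t)` -/

/-- The differential equation `t d/dt ζ(γ₀ t) = γ₀ t ζ(γ₀ t) - 1`: up to the constant, `ζ(γ₀ t)`
satisfies the equation of `exp(γ₀ t)`. -/
lemma mul_zetaCoeff {γ₀ : ℂ_[p]} (h0 : γ₀ ≠ 0) (k : ℤ) :
    (k : ℂ_[p]) * zetaCoeff γ₀ k = γ₀ * zetaCoeff γ₀ (k - 1) - if k = 0 then 1 else 0 := by
  rcases lt_trichotomy k 0 with hk | rfl | hk
  · obtain ⟨i, rfl⟩ : ∃ i : ℕ, k = -(i + 1 : ℕ) := ⟨(-k - 1).toNat, by push_cast; lia⟩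
    have h1 : (-((i + 1 : ℕ) : ℤ) - 1) = -((i + 1 + 1 : ℕ) : ℤ) := by push_cast; ring
    rw [h1, zetaCoeff_neg_succ, zetaCoeff_neg_succ, if_neg hk.ne, Nat.factorial_succ, zpow_neg,
      zpow_neg, zpow_natCast, zpow_natCast]
    push_cast
    field_simp
    ring
  · have := zetaCoeff_neg_succ γ₀ 0
    rw [zetaCoeff_of_nonneg γ₀ le_rfl]
    simp only [zero_add, Nat.cast_one] at this
    simp [this, h0]
  · rw [zetaCoeff_of_nonneg γ₀ hk.le, zetaCoeff_of_nonneg γ₀ (by lia), if_neg hk.ne']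
    simp

lemma mul_frobOne_zetaCoeff {γ₀ : ℂ_[p]} (h0 : γ₀ ≠ 0) (k : ℤ) :
    (k : ℂ_[p]) * frobOne (zetaCoeff γ₀) k =
      p * γ₀ * frobOne (zetaCoeff γ₀) (k - p) - if k = 0 then (p : ℂ_[p]) else 0 := by
  have hp : (p : ℤ) ≠ 0 := by exact_mod_cast prime_ne_zero
  by_cases hk : (p : ℤ) ∣ k
  · obtain ⟨m, rfl⟩ := hk
    have h1 : (p : ℤ) * m - p = p * (m - 1) := by ring
    have h2 := mul_zetaCoeff h0 m
    rw [h1, frobOne_mul, frobOne_mul, Int.cast_mul, Int.cast_natCast, mul_assoc, h2]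
    simp only [mul_eq_zero, hp, false_or]
    split_ifs <;> ring
  · rw [frobOne_of_not_dvd _ hk, frobOne_of_not_dvd _ (by rwa [dvd_sub_self_right]), if_neg]
    · simp
    · rintro rfl; exact hk (dvd_zero _)

lemma ofPowerSeries_X_pow_mul (f : ℂ_[p]⟦X⟧) (n : ℕ) (k : ℤ) :
    ofPowerSeries (PowerSeries.X ^ n * f) k = ofPowerSeries f (k - n) := by
  rcases lt_or_ge k 0 with hk | hk
  · rw [ofPowerSeries_of_neg _ hk, ofPowerSeries_of_neg _ (by lia)]
  · lift k to ℕ using hk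
    rw [ofPowerSeries_natCast, PowerSeries.coeff_X_pow_mul']
    split_ifs with h
    · rw [← Nat.cast_sub h, ofPowerSeries_natCast]
    · rw [ofPowerSeries_of_neg _ (by lia)]

lemma mul_ofPowerSeries_splitting (γ₀ : ℂ_[p]) (k : ℤ) :
    (k : ℂ_[p]) * ofPowerSeries (splitting γ₀) k =
      γ₀ * ofPowerSeries (splitting γ₀) (k - 1) -
        p * γ₀ * ofPowerSeries (splitting γ₀) (k - p) := by
  rcases lt_or_ge k 0 with hk | hk
  · rw [ofPowerSeries_of_neg _ hk, ofPowerSeries_of_neg _ (by lia), ofPowerSeries_of_neg _ (by lia)]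
    simp
  · have h1 := ofPowerSeries_X_pow_mul (splitting γ₀) 1 k
    have h2 := ofPowerSeries_X_pow_mul (splitting γ₀) p k
    rw [pow_one, Nat.cast_one] at h1
    rw [← h1, ← h2]
    lift k to ℕ using hk
    simp only [ofPowerSeries_natCast]
    rw [Int.cast_natCast, ← coeff_euler, euler_splitting, add_mul, map_add, mul_assoc, mul_assoc,
      PowerSeries.coeff_C_mul, PowerSeries.coeff_C_mul]
    ring

/-- The sum over `d` of these identities is the differential equation of
`exp(γ₀ (t - t ^ p)) ζ(γ₀ t ^ p)` in degree `k`; the two terms with the factor `p γ₀` cancel. -/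
lemma mul_mulTerm_splitting {γ₀ : ℂ_[p]} (h0 : γ₀ ≠ 0) (k d : ℤ) :
    (k : ℂ_[p]) * mulTerm (ofPowerSeries (splitting γ₀)) (frobOne (zetaCoeff γ₀)) k d =
      γ₀ * mulTerm (ofPowerSeries (splitting γ₀)) (frobOne (zetaCoeff γ₀)) (k - 1) (d - 1) -
        p * γ₀ * mulTerm (ofPowerSeries (splitting γ₀)) (frobOne (zetaCoeff γ₀)) (k - p) (d - p) +
        p * γ₀ * mulTerm (ofPowerSeries (splitting γ₀)) (frobOne (zetaCoeff γ₀)) (k - p) d -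
        if d = k then p * ofPowerSeries (splitting γ₀) k else 0 := by
  have e1 := mul_ofPowerSeries_splitting γ₀ d
  have e2 := mul_frobOne_zetaCoeff h0 (k - d)
  have e3 : k - 1 - (d - 1) = k - d := by ring
  have e4 : k - p - (d - p) = k - d := by ring
  have e5 : k - p - d = k - d - p := by ring
  have e7 : (k : ℂ_[p]) = d + ((k - d : ℤ) : ℂ_[p]) := by push_cast; ring
  simp only [mulTerm, e3, e4, e5]
  rw [e7]
  generalize frobOne (zetaCoeff γ₀) (k - d) = z at *
  generalize frobOne (zetaCoeff γ₀) (k - d - p) = z' at *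
  by_cases h : d = k
  · rw [if_pos h]
    rw [if_pos (sub_eq_zero.2 h.symm)] at e2
    rw [← h] at e2 ⊢
    linear_combination z * e1 + ofPowerSeries (splitting γ₀) d * e2
  · rw [if_neg h]
    rw [if_neg (fun h' => h (sub_eq_zero.1 h').symm)] at e2
    linear_combination z * e1 + ofPowerSeries (splitting γ₀) d * e2

lemma mul_splitting_formalMul {γ₀ : ℂ_[p]} (hγ₀ : IsDworkZero γ₀) (k : ℤ) :
    (k : ℂ_[p]) * formalMul (ofPowerSeries (splitting γ₀)) (frobOne (zetaCoeff γ₀)) k =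
      γ₀ * formalMul (ofPowerSeries (splitting γ₀)) (frobOne (zetaCoeff γ₀)) (k - 1) -
        p * ofPowerSeries (splitting γ₀) k := by
  have hsum (k : ℤ) : HasSum (mulTerm (ofPowerSeries (splitting γ₀)) (frobOne (zetaCoeff γ₀)) k)
      (formalMul (ofPowerSeries (splitting γ₀)) (frobOne (zetaCoeff γ₀)) k) :=
    (summable_mulTerm hγ₀.overconvergent_splitting
      hγ₀.subexponentialGrowth_zetaCoeff.frobOne k).hasSum
  have h1 := (hsum k).mul_left (k : ℂ_[p])
  have h2 := ((Equiv.subRight (1 : ℤ)).hasSum_iff.2 (hsum (k - 1))).mul_left γ₀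
  have h3 := ((Equiv.subRight (p : ℤ)).hasSum_iff.2 (hsum (k - p))).mul_left (p * γ₀)
  have h4 := (hsum (k - p)).mul_left (p * γ₀)
  have h5 := hasSum_ite_eq k (p * ofPowerSeries (splitting γ₀) k)
  have h6 := ((h2.sub h3).add h4).sub h5
  have h7 := h6.congr_fun fun d => mul_mulTerm_splitting hγ₀.ne_zero k d
  rw [h1.unique h7]
  ring

/-- The principal part of `exp(γ₀ (t - t ^ p)) ζ(γ₀ t ^ p)` is `p ζ(γ₀ t)`: the product `w`
satisfies `t w' = γ₀ t w - p exp(γ₀ (t - t ^ p))`, so that up to the factor `p` the coefficients of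
negative degree obey the recursion of those of `ζ(γ₀ t)`. -/
lemma splitting_formalMul_frobOne_zetaCoeff {γ₀ : ℂ_[p]} (hγ₀ : IsDworkZero γ₀) {k : ℤ}
    (hk : k < 0) : formalMul (ofPowerSeries (splitting γ₀)) (frobOne (zetaCoeff γ₀)) k =
      p * zetaCoeff γ₀ k := by
  have h0 := hγ₀.ne_zero
  have hE0 (k : ℤ) (hk : k ≤ 0) :
      ofPowerSeries (splitting γ₀) k = if k = 0 then 1 else 0 := by
    split_ifs with h
    · have := ofPowerSeries_natCast (splitting γ₀) 0
      rw [Nat.cast_zero] at this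
      rw [h, this, PowerSeries.coeff_zero_eq_constantCoeff_apply, constantCoeff_splitting]
    · exact ofPowerSeries_of_neg _ (by lia)
  have hrec := mul_splitting_formalMul hγ₀
  generalize formalMul (ofPowerSeries (splitting γ₀)) (frobOne (zetaCoeff γ₀)) = w at hrec ⊢
  have step (k : ℤ) (hk : k ≤ 0) (hw : (k : ℂ_[p]) * w k = k * (p * zetaCoeff γ₀ k)) :
      w (k - 1) = p * zetaCoeff γ₀ (k - 1) := by
    have e1 := hrec k
    have e2 := mul_zetaCoeff h0 k
    rw [hE0 k hk] at e1
    refine mul_left_cancel₀ h0 ?_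
    linear_combination hw - e1 + p * e2
  have main (i : ℕ) : w (-(i + 1 : ℕ)) = p * zetaCoeff γ₀ (-(i + 1 : ℕ)) := by
    induction i with
    | zero => simpa using step 0 le_rfl (by simp)
    | succ i ih =>
      have e : (-((i + 1 + 1 : ℕ) : ℤ)) = -((i + 1 : ℕ) : ℤ) - 1 := by push_cast; ring
      rw [e]
      exact step _ (by push_cast; lia) (by rw [ih])
  obtain ⟨i, rfl⟩ : ∃ i : ℕ, k = -(i + 1 : ℕ) := ⟨(-k - 1).toNat, by push_cast; lia⟩
  exact main i

lemma zetaThetaCoeff_eq (γ₀ : ℂ_[p]) :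
    zetaThetaCoeff γ₀ = formalMul (ofPowerSeries (thetaHatOne γ₀)) (zetaCoeff γ₀) :=
  formalMul_comm _ _

lemma IsDworkZero.subexponentialGrowth_zetaThetaCoeff {γ₀ : ℂ_[p]} (hγ₀ : IsDworkZero γ₀) :
    SubexponentialGrowth (zetaThetaCoeff γ₀) := by
  rw [zetaThetaCoeff_eq]
  exact hγ₀.subexponentialGrowth_zetaCoeff.formalMul hγ₀.overconvergent_thetaHatOne

/-- In negative degrees, `q(t) = ζ(γ₀ t) θ̂₁(t)` satisfies `θ(t) q(t ^ p) = p q(t)`. -/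
lemma theta_formalMul_frobOne_zetaThetaCoeff {γ₀ : ℂ_[p]} (hγ₀ : IsDworkZero γ₀) {k : ℤ}
    (hk : k < 0) : formalMul (ofPowerSeries (theta γ₀)) (frobOne (zetaThetaCoeff γ₀)) k =
      p * zetaThetaCoeff γ₀ k := by
  have hz := hγ₀.subexponentialGrowth_zetaCoeff
  have ht := hγ₀.overconvergent_thetaHatOne
  rw [zetaThetaCoeff_eq, frobOne_formalMul,
    ← formalMul_mul hγ₀.overconvergent_theta (ht.expand _) hz.frobOne,
    ← splitting_mul_thetaHatOne, mul_comm,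
    formalMul_mul ht hγ₀.overconvergent_splitting hz.frobOne,
    formalMul_eq_of_eqOn_neg (h' := fun k => (p : ℂ_[p]) * zetaCoeff γ₀ k) _
      (fun k hk => splitting_formalMul_frobOne_zetaCoeff hγ₀ hk) hk,
    formalMul, formalMul, ← tsum_mul_left]
  refine tsum_congr fun d => ?_
  rw [mulTerm, mulTerm, mul_left_comm]

/-- The principal part of `ζ(γ₀ t) θ̂₁(t)` does not vanish, because multiplication by `θ̂₁⁻¹`
recovers that of `ζ(γ₀ t)`. -/
lemma exists_zetaThetaCoeff_ne_zero {γ₀ : ℂ_[p]} (hγ₀ : IsDworkZero γ₀) :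
    ∃ k < 0, zetaThetaCoeff γ₀ k ≠ 0 := by
  by_contra! h
  have ht := hγ₀.overconvergent_thetaHatOne
  have h1 : formalMul (ofPowerSeries (thetaHatOne γ₀)⁻¹) (zetaThetaCoeff γ₀) = zetaCoeff γ₀ := by
    rw [zetaThetaCoeff_eq, ← formalMul_mul (ht.inv (constantCoeff_thetaHatOne γ₀)) ht
      hγ₀.subexponentialGrowth_zetaCoeff,
      PowerSeries.inv_mul_cancel _ (constantCoeff_thetaHatOne_ne_zero γ₀), one_formalMul]
  have h2 : zetaCoeff γ₀ (-1) = 0 := by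
    rw [← h1, formalMul_eq_of_eqOn_neg (h' := fun _ => 0) _ h (by norm_num), formalMul]
    simp [mulTerm]
  have h3 := mul_zetaCoeff hγ₀.ne_zero 0
  simp [h2] at h3

lemma theta_formalMul_frobOne_expThetaCoeff (γ₀ : ℂ_[p]) :
    formalMul (ofPowerSeries (theta γ₀)) (frobOne (expThetaCoeff γ₀)) = expThetaCoeff γ₀ := by
  rw [expThetaCoeff, frobOne_ofPowerSeries, formalMul_ofPowerSeries, theta_mul_expand]

/-! ### The relative interior of the cone -/

section Cone

variable {n N : ℕ} {a : Fin N → Fin n → ℤ}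

lemma zero_mem_cone : (0 : Fin n → ℝ) ∈ cone a := Submodule.zero_mem _

lemma add_mem_cone {x y : Fin n → ℝ} (hx : x ∈ cone a) (hy : y ∈ cone a) : x + y ∈ cone a :=
  Submodule.add_mem _ hx hy

lemma smul_mem_cone {x : Fin n → ℝ} (hx : x ∈ cone a) {c : ℝ} (hc : 0 ≤ c) : c • x ∈ cone a :=
  Submodule.smul_mem (PointedCone.hull ℝ (Set.range fun j => toReal (a j))) ⟨c, hc⟩ hx

lemma generator_mem_cone (j : Fin N) : toReal (a j) ∈ cone a := Submodule.subset_span ⟨j, rfl⟩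

lemma mem_intrinsicInterior_iff_nhdsWithin {E : Type*} [NormedAddCommGroup E] [NormedSpace ℝ E]
    {s : Set E} {x : E} :
    x ∈ intrinsicInterior ℝ s ↔ x ∈ affineSpan ℝ s ∧ s ∈ 𝓝[affineSpan ℝ s] x := by
  rw [mem_intrinsicInterior]
  constructor
  · rintro ⟨y, hy, rfl⟩
    refine ⟨y.2, ?_⟩
    rw [mem_interior_iff_mem_nhds] at hy
    rwa [← preimage_coe_mem_nhds_subtype]
  · rintro ⟨hx, hs⟩
    refine ⟨⟨x, hx⟩, ?_, rfl⟩
    rw [mem_interior_iff_mem_nhds]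
    exact preimage_coe_mem_nhds_subtype.2 hs

lemma add_mem_affineSpan_cone {x y : Fin n → ℝ} (hx : x ∈ affineSpan ℝ (cone a))
    (hy : y ∈ affineSpan ℝ (cone a)) (c : ℝ) : x + c • y ∈ affineSpan ℝ (cone a) := by
  have h0 : (0 : Fin n → ℝ) ∈ affineSpan ℝ (cone a) := subset_affineSpan ℝ _ zero_mem_cone
  have h1 : c • (y -ᵥ (0 : Fin n → ℝ)) ∈ (affineSpan ℝ (cone a)).direction :=
    Submodule.smul_mem _ c (AffineSubspace.vsub_mem_direction hy h0)
  have h2 := AffineSubspace.vadd_mem_of_mem_direction h1 hx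
  rwa [vsub_eq_sub, sub_zero, vadd_eq_add, add_comm] at h2

lemma add_mem_coneInterior {x y : Fin n → ℝ} (hx : x ∈ coneInterior a) (hy : y ∈ cone a) :
    x + y ∈ coneInterior a := by
  rw [coneInterior, mem_intrinsicInterior_iff_nhdsWithin] at hx ⊢
  have hyT := subset_affineSpan ℝ _ hy
  refine ⟨by simpa using add_mem_affineSpan_cone hx.1 hyT 1, ?_⟩
  have hsub (z : Fin n → ℝ) (hz : z ∈ affineSpan ℝ (cone a)) : z - y ∈ affineSpan ℝ (cone a) := by
    simpa [sub_eq_add_neg] using add_mem_affineSpan_cone hz hyT (-1)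
  have ht : Tendsto (fun z : Fin n → ℝ => z - y) (𝓝[affineSpan ℝ (cone a)] (x + y))
      (𝓝[affineSpan ℝ (cone a)] x) := by
    have h := (continuous_sub_right y : Continuous fun z : Fin n → ℝ => z - y)
    have h' := h.continuousWithinAt (s := affineSpan ℝ (cone a)) (x := x + y)
    simpa using h'.tendsto_nhdsWithin hsub
  filter_upwards [ht hx.2] with z hz
  have := add_mem_cone hz hy
  rwa [sub_add_cancel] at this

lemma smul_mem_coneInterior {x : Fin n → ℝ} (hx : x ∈ coneInterior a) {c : ℝ} (hc : 0 < c) :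
    c • x ∈ coneInterior a := by
  rw [coneInterior, mem_intrinsicInterior_iff_nhdsWithin] at hx ⊢
  have h0 : (0 : Fin n → ℝ) ∈ affineSpan ℝ (cone a) := subset_affineSpan ℝ _ zero_mem_cone
  have hsmul (b : ℝ) (z : Fin n → ℝ) (hz : z ∈ affineSpan ℝ (cone a)) :
      b • z ∈ affineSpan ℝ (cone a) := by
    simpa using add_mem_affineSpan_cone h0 hz b
  refine ⟨hsmul c x hx.1, ?_⟩
  have ht : Tendsto (fun z : Fin n → ℝ => c⁻¹ • z) (𝓝[affineSpan ℝ (cone a)] (c • x))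
      (𝓝[affineSpan ℝ (cone a)] x) := by
    have h := (continuous_const_smul c⁻¹ : Continuous fun z : Fin n → ℝ => c⁻¹ • z)
    have h' := h.continuousWithinAt (s := affineSpan ℝ (cone a)) (x := c • x)
    simpa [smul_smul, inv_mul_cancel₀ hc.ne'] using h'.tendsto_nhdsWithin (hsmul c⁻¹)
  filter_upwards [ht hx.2] with z hz
  have := smul_mem_cone hz hc.le
  rwa [smul_smul, mul_inv_cancel₀ hc.ne', one_smul] at this

lemma toReal_sum_smul {ι : Type*} (s : Finset ι) (m : ι → ℤ) (b : ι → Fin n → ℤ) :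
    toReal (∑ j ∈ s, m j • b j) = ∑ j ∈ s, (m j : ℝ) • toReal (b j) := by
  funext i
  simp [toReal, Finset.sum_apply]

lemma toReal_sum_smul_mem_cone (s : Finset (Fin N)) {m : Fin N → ℤ} (hm : ∀ j ∈ s, 0 ≤ m j) :
    toReal (∑ j ∈ s, m j • a j) ∈ cone a := by
  rw [toReal_sum_smul]
  exact Submodule.sum_mem (PointedCone.hull ℝ (Set.range fun j => toReal (a j))) fun j hj =>
    smul_mem_cone (generator_mem_cone j) (Int.cast_nonneg (hm j hj))

lemma toReal_add (u v : Fin n → ℤ) : toReal (u + v) = toReal u + toReal v := by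
  funext i; simp [toReal]

lemma toReal_neg (u : Fin n → ℤ) : toReal (-u) = -toReal u := by
  funext i; simp [toReal]

lemma toReal_smul (c : ℤ) (u : Fin n → ℤ) : toReal (c • u) = (c : ℝ) • toReal u := by
  funext i; simp [toReal]

/-- If some combination of the generators indexed by `s` lies in the relative interior, then so does
their sum: after adding further generators, the combination becomes a multiple of the sum. -/
lemma toReal_sum_mem_coneInterior {s : Finset (Fin N)} {m : Fin N → ℤ}
    (h : toReal (∑ j ∈ s, m j • a j) ∈ coneInterior a) :
    toReal (∑ j ∈ s, a j) ∈ coneInterior a := by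
  -- a common upper bound of the multiplicities
  obtain ⟨c, hc0, hc⟩ : ∃ c : ℤ, 0 < c ∧ ∀ j ∈ s, m j ≤ c := by
    refine ⟨1 + ∑ j ∈ s, |m j|, ?_, fun j hj => ?_⟩
    · have := Finset.sum_nonneg fun j (_ : j ∈ s) => abs_nonneg (m j)
      lia
    have := Finset.single_le_sum (fun j (_ : j ∈ s) => abs_nonneg (m j)) hj
    have := le_abs_self (m j)
    lia
  have h1 := add_mem_coneInterior h (toReal_sum_smul_mem_cone (a := a) s
    (m := fun j => c - m j) fun j hj => sub_nonneg.2 (hc j hj))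
  have h2 : ∑ j ∈ s, m j • a j + ∑ j ∈ s, (c - m j) • a j = c • ∑ j ∈ s, a j := by
    rw [← Finset.sum_add_distrib, Finset.smul_sum]
    exact Finset.sum_congr rfl fun j _ => by rw [← add_smul, add_sub_cancel]
  rw [← toReal_add, h2, toReal_smul] at h1
  have hcR : (0 : ℝ) < c := by exact_mod_cast hc0
  have h3 := smul_mem_coneInterior h1 (inv_pos.2 hcR)
  rwa [smul_smul, inv_mul_cancel₀ hcR.ne', one_smul] at h3

/-- A point of `ℳ` has negative coordinates at all the vectors of the minimal set `A'` in every
representation with nonnegative coordinates outside of `A'`. -/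
lemma neg_of_mem_negInteriorLattice {M : ℕ} (hmin : IsMinimalFor M a) {μ : Fin N → ℤ}
    (hμ : ∑ j, μ j • a j ∈ negInteriorLattice a) (hpos : ∀ j : Fin N, M ≤ j.val → 0 ≤ μ j)
    (j : Fin N) (hj : j.val < M) : μ j < 0 := by
  by_contra! hj0
  set J := Finset.univ.filter fun i : Fin N => μ i < 0 with hJ
  have h1 := add_mem_coneInterior hμ.1 (toReal_sum_smul_mem_cone (a := a)
    (Finset.univ.filter fun i : Fin N => ¬ μ i < 0) (m := μ) fun i hi => by simpa using hi)
  have h2 : -∑ i, μ i • a i + ∑ i with ¬ μ i < 0, μ i • a i = ∑ i ∈ J, (-μ i) • a i := by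
    rw [← Finset.sum_filter_add_sum_filter_not Finset.univ (fun i : Fin N => μ i < 0)]
    simp only [neg_smul, Finset.sum_neg_distrib]
    abel
  rw [← toReal_neg, ← toReal_add, h2] at h1
  refine hmin.2 J ?_ (toReal_sum_mem_coneInterior h1)
  refine (Finset.ssubset_iff_of_subset fun i hi => ?_).2 ⟨j, by simp [hj], by simp [hJ, hj0]⟩
  rw [hJ, Finset.mem_filter] at hi
  rw [Finset.mem_filter]
  refine ⟨Finset.mem_univ i, ?_⟩
  by_contra! hi'
  exact (hpos i hi').not_gt hi.2

lemma sum_smul_mem_closure (μ : Fin N → ℤ) :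
    ∑ j, μ j • a j ∈ AddSubgroup.closure (Set.range a) :=
  sum_mem fun j _ => zsmul_mem (AddSubgroup.subset_closure (Set.mem_range_self j)) (μ j)

/-- If `∑ (ν_j + c σ_j) a_j` lies in `ℳ`, with `ν ≥ 0` and `c > 0`, then so does `∑ σ_j a_j`. -/
lemma mem_negInteriorLattice_of_add {μ ν σ : Fin N → ℤ} {c : ℤ} (hc : 0 < c)
    (hμ : ∑ j, μ j • a j ∈ negInteriorLattice a) (hν : ∀ j, 0 ≤ ν j)
    (h : ∀ j, μ j - ν j = c * σ j) : ∑ j, σ j • a j ∈ negInteriorLattice a := by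
  refine ⟨?_, sum_smul_mem_closure σ⟩
  have h1 := add_mem_coneInterior hμ.1 (toReal_sum_smul_mem_cone (a := a) Finset.univ (m := ν)
    fun j _ => hν j)
  have h2 : -∑ j, μ j • a j + ∑ j, ν j • a j = c • (-∑ j, σ j • a j) := by
    rw [← Finset.sum_neg_distrib, ← Finset.sum_neg_distrib, ← Finset.sum_add_distrib,
      Finset.smul_sum]
    refine Finset.sum_congr rfl fun j _ => ?_
    rw [← neg_smul, ← neg_smul, ← add_smul, smul_smul]
    congr 1
    linear_combination -(h j)
  rw [← toReal_neg, ← toReal_add, h2, toReal_smul] at h1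
  have hcR : (0 : ℝ) < c := by exact_mod_cast hc
  have h3 := smul_mem_coneInterior h1 (inv_pos.2 hcR)
  rwa [smul_smul, inv_mul_cancel₀ hcR.ne', one_smul, toReal_neg] at h3

end Cone

/-! ### The generating series -/

/-- The product of finitely many absolutely convergent series, expanded. -/
lemma tsum_prod_pi {K : Type*} [NormedField K] [CompleteSpace K] {N : ℕ}
    {f : Fin N → ℤ → K} (hf : ∀ j, Summable fun k => ‖f j k‖) :
    (Summable fun ν : Fin N → ℤ => ‖∏ j, f j (ν j)‖) ∧
      ∑' ν : Fin N → ℤ, ∏ j, f j (ν j) = ∏ j, ∑' k, f j k := by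
  induction N with
  | zero => simp [Summable.of_finite]
  | succ N ih =>
    obtain ⟨h1, h2⟩ := ih (f := fun j => f j.succ) fun j => hf j.succ
    let e : ℤ × (Fin N → ℤ) ≃ (Fin (N + 1) → ℤ) := Fin.consEquiv fun _ => ℤ
    have he (q : ℤ × (Fin N → ℤ)) :
        ∏ j, f j (e q j) = f 0 q.1 * ∏ j : Fin N, f j.succ (q.2 j) := by
      rw [Fin.prod_univ_succ]; rfl
    constructor
    · rw [← e.summable_iff]
      refine ((hf 0).mul_norm h1).congr fun q => ?_
      rw [Function.comp, he]
    · rw [← e.tsum_eq, Fin.prod_univ_succ, ← h2, tsum_mul_tsum_of_summable_norm (hf 0) h1]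
      exact tsum_congr he

lemma summable_norm_mulTerm_ofPowerSeries (f g : ℂ_[p]⟦X⟧) (k : ℤ) :
    Summable fun d => ‖mulTerm (ofPowerSeries f) (ofPowerSeries g) k d‖ := by
  refine summable_of_ne_finset_zero (s := Finset.Icc 0 k) fun d hd => ?_
  rw [norm_eq_zero, mulTerm]
  rw [Finset.mem_Icc, not_and_or, not_le, not_le] at hd
  rcases hd with hd | hd
  · rw [ofPowerSeries_of_neg _ hd, zero_mul]
  · rw [ofPowerSeries_of_neg g (by lia), mul_zero]

/-- The one-variable series whose product over `j` makes up `G` before `δ_ℳ` is applied. -/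
def factorCoeff (γ₀ : ℂ_[p]) (M : ℕ) {N : ℕ} (j : Fin N) : ℤ → ℂ_[p] :=
  if j.val < M then zetaThetaCoeff γ₀ else expThetaCoeff γ₀

lemma summable_norm_mulTerm_factorCoeff {γ₀ : ℂ_[p]} (hγ₀ : IsDworkZero γ₀) (M : ℕ) {N : ℕ}
    (j : Fin N) (k : ℤ) : Summable fun d =>
      ‖mulTerm (ofPowerSeries (theta γ₀)) (frobOne (factorCoeff γ₀ M j)) k d‖ := by
  rw [factorCoeff]
  split_ifs
  · exact summable_norm_mulTerm hγ₀.overconvergent_theta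
      hγ₀.subexponentialGrowth_zetaThetaCoeff.frobOne k
  · rw [expThetaCoeff, frobOne_ofPowerSeries]
    exact summable_norm_mulTerm_ofPowerSeries _ _ k

section Series

variable {n N : ℕ} {a : Fin N → Fin n → ℤ}

lemma prodSubst_apply_sum (f : Fin N → ℤ → ℂ_[p]) (μ : Fin N → ℤ) :
    prodSubst a f (μ, ∑ j, μ j • a j) = ∏ j, f j (μ j) := if_pos rfl

lemma prodSubst_of_ne (f : Fin N → ℤ → ℂ_[p]) {μ : Fin N → ℤ} {u : Fin n → ℤ}
    (h : u ≠ ∑ j, μ j • a j) : prodSubst a f (μ, u) = 0 := if_neg h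

lemma delta_of_mem {S : Set (Fin n → ℤ)} {f : LambdaXSeries p N n} {μ : Fin N → ℤ}
    {u : Fin n → ℤ} (h : u ∈ S) : delta S f (μ, u) = f (μ, u) := if_pos h

lemma delta_of_notMem {S : Set (Fin n → ℤ)} {f : LambdaXSeries p N n} {μ : Fin N → ℤ}
    {u : Fin n → ℤ} (h : u ∉ S) : delta S f (μ, u) = 0 := if_neg h

lemma genSeries_eq (γ₀ : ℂ_[p]) (M : ℕ) :
    genSeries γ₀ M a = delta (negInteriorLattice a) (prodSubst a (factorCoeff γ₀ M)) := rfl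

lemma genSeries_of_ne (γ₀ : ℂ_[p]) (M : ℕ) {μ : Fin N → ℤ} {u : Fin n → ℤ}
    (h : u ≠ ∑ j, μ j • a j) : genSeries γ₀ M a (μ, u) = 0 := by
  rw [genSeries_eq]
  by_cases hu : u ∈ negInteriorLattice a
  · rw [delta_of_mem hu, prodSubst_of_ne _ h]
  · rw [delta_of_notMem hu]

lemma frobSubst_smul (f : LambdaXSeries p N n) (σ : Fin N → ℤ) (u : Fin n → ℤ) :
    frobSubst f ((p : ℤ) • σ, (p : ℤ) • u) = f (σ, u) := by
  have hp : (p : ℤ) ≠ 0 := by exact_mod_cast prime_ne_zero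
  rw [frobSubst, if_pos ⟨fun j => ⟨σ j, rfl⟩, fun i => ⟨u i, rfl⟩⟩]
  congr 2
  · funext j; exact Int.mul_ediv_cancel_left _ hp
  · funext i; exact Int.mul_ediv_cancel_left _ hp

lemma frobSubst_genSeries_of_ne (γ₀ : ℂ_[p]) (M : ℕ) {μ : Fin N → ℤ} {u : Fin n → ℤ}
    (h : u ≠ ∑ j, μ j • a j) : frobSubst (genSeries γ₀ M a) (μ, u) = 0 := by
  rw [frobSubst]
  split_ifs with hd
  · refine genSeries_of_ne γ₀ M fun h' => h ?_
    choose σ hσ using hd.1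
    choose w hw using hd.2
    have hp : (p : ℤ) ≠ 0 := by exact_mod_cast prime_ne_zero
    dsimp only at hσ hw h'
    funext i
    have := congrFun h' i
    simp only [hσ, hw, Int.mul_ediv_cancel_left _ hp] at this
    rw [hw i, this, Finset.sum_apply, Finset.sum_apply, Finset.mul_sum]
    exact Finset.sum_congr rfl fun j _ => by simp [hσ, mul_assoc]
  · rfl

lemma sum_sub_smul (μ ν : Fin N → ℤ) :
    ∑ j, (μ - ν) j • a j = ∑ j, μ j • a j - ∑ j, ν j • a j := by
  rw [← Finset.sum_sub_distrib]
  exact Finset.sum_congr rfl fun j _ => by rw [Pi.sub_apply, sub_smul]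

/-- A factor of `Λ`-exponent `ν` and `x`-exponent `v` contributes to the product only if
`v = ∑ ν_j a_j`. -/
lemma mulTerm_genSeries_of_ne (γ₀ : ℂ_[p]) (M : ℕ) (e : (Fin N → ℤ) × (Fin n → ℤ))
    {d : (Fin N → ℤ) × (Fin n → ℤ)} (hd : d.2 ≠ ∑ j, d.1 j • a j) :
    mulTerm (thetaSeries γ₀ a) (frobSubst (genSeries γ₀ M a)) e d = 0 := by
  rw [mulTerm, thetaSeries, prodSubst_of_ne _ hd, zero_mul]

lemma mulTerm_genSeries_eq_zero (γ₀ : ℂ_[p]) (M : ℕ) {μ : Fin N → ℤ} {ρ : Fin n → ℤ}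
    (h : ρ ≠ ∑ j, μ j • a j) (d : (Fin N → ℤ) × (Fin n → ℤ)) :
    mulTerm (thetaSeries γ₀ a) (frobSubst (genSeries γ₀ M a)) (μ, ρ) d = 0 := by
  obtain ⟨ν, v⟩ := d
  by_cases hd : v = ∑ j, ν j • a j
  · rw [mulTerm, Prod.mk_sub_mk, frobSubst_genSeries_of_ne, mul_zero]
    rw [sum_sub_smul, ← hd]
    exact fun h' => h (sub_left_injective h')
  · exact mulTerm_genSeries_of_ne γ₀ M _ hd

/-- On the exponents that contribute, the terms of the product factor over `j`: the projection `δ_ℳ`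
inside `G` imposes no condition, as `-C(A)°` is stable under subtracting elements of `C(A)` and under
division by `p`. -/
lemma mulTerm_genSeries (γ₀ : ℂ_[p]) (M : ℕ) {μ : Fin N → ℤ}
    (hμ : ∑ j, μ j • a j ∈ negInteriorLattice a) (ν : Fin N → ℤ) :
    mulTerm (thetaSeries γ₀ a) (frobSubst (genSeries γ₀ M a)) (μ, ∑ j, μ j • a j)
      (ν, ∑ j, ν j • a j) =
    ∏ j, mulTerm (ofPowerSeries (theta γ₀)) (frobOne (factorCoeff γ₀ M j)) (μ j) (ν j) := by
  have hp : (0 : ℤ) < p := by exact_mod_cast (Fact.out : p.Prime).pos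
  simp only [mulTerm]
  rw [thetaSeries, prodSubst_apply_sum, Finset.prod_mul_distrib, Prod.mk_sub_mk, ← sum_sub_smul]
  by_cases hν : ∀ j, 0 ≤ ν j
  · congr 1
    by_cases hd : ∀ j, (p : ℤ) ∣ μ j - ν j
    · choose σ hσ using hd
      have e1 : μ - ν = (p : ℤ) • σ := funext hσ
      have e2 : ∑ j, (μ - ν) j • a j = (p : ℤ) • ∑ j, σ j • a j := by
        rw [e1, Finset.smul_sum]
        exact Finset.sum_congr rfl fun j _ => by rw [Pi.smul_apply, smul_smul, smul_eq_mul]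
      rw [e2, e1, frobSubst_smul, genSeries_eq,
        delta_of_mem (mem_negInteriorLattice_of_add hp hμ hν hσ), prodSubst_apply_sum]
      exact Finset.prod_congr rfl fun j _ => by rw [hσ, frobOne_mul]
    · rw [frobSubst, if_neg (fun h => hd h.1)]
      rw [not_forall] at hd
      obtain ⟨j, hj⟩ := hd
      exact (Finset.prod_eq_zero (Finset.mem_univ j) (frobOne_of_not_dvd _ hj)).symm
  · rw [not_forall] at hν
    obtain ⟨j, hj⟩ := hν
    rw [Finset.prod_eq_zero (Finset.mem_univ j) (ofPowerSeries_of_neg _ (not_le.1 hj)), zero_mul,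
      zero_mul]

lemma graph_injective (a : Fin N → Fin n → ℤ) :
    Function.Injective fun ν : Fin N → ℤ => (ν, ∑ j, ν j • a j) :=
  fun _ _ h => congrArg Prod.fst h

lemma support_mulTerm_genSeries (γ₀ : ℂ_[p]) (M : ℕ) (e : (Fin N → ℤ) × (Fin n → ℤ)) :
    Function.support (mulTerm (thetaSeries γ₀ a) (frobSubst (genSeries γ₀ M a)) e) ⊆
      Set.range fun ν : Fin N → ℤ => (ν, ∑ j, ν j • a j) := by
  rintro ⟨ν, v⟩ hd
  by_contra hd'
  exact hd (mulTerm_genSeries_of_ne γ₀ M e fun h =>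
    hd' ⟨ν, by rw [Prod.mk.injEq]; exact ⟨rfl, h.symm⟩⟩)

lemma summable_mulTerm_genSeries {γ₀ : ℂ_[p]} (hγ₀ : IsDworkZero γ₀) (M : ℕ) :
    DworkFrobeniusConverges γ₀ a (genSeries γ₀ M a) := by
  intro μ ρ hρ
  by_cases h : ρ = ∑ j, μ j • a j
  · subst h
    rw [← (graph_injective a).summable_iff (fun d hd => by
      by_contra h
      exact hd (support_mulTerm_genSeries γ₀ M _ h))]
    refine (tsum_prod_pi fun j =>
      summable_norm_mulTerm_factorCoeff hγ₀ M j (μ j)).1.of_norm.congr fun ν => ?_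
    exact (mulTerm_genSeries γ₀ M hρ ν).symm
  · exact summable_zero.congr fun d => (mulTerm_genSeries_eq_zero γ₀ M h d).symm

lemma formalMul_genSeries {γ₀ : ℂ_[p]} (hγ₀ : IsDworkZero γ₀) (M : ℕ) {μ : Fin N → ℤ}
    (hμ : ∑ j, μ j • a j ∈ negInteriorLattice a) :
    formalMul (thetaSeries γ₀ a) (frobSubst (genSeries γ₀ M a)) (μ, ∑ j, μ j • a j) =
      ∏ j, formalMul (ofPowerSeries (theta γ₀)) (frobOne (factorCoeff γ₀ M j)) (μ j) := by
  rw [formalMul, ← (graph_injective a).tsum_eq (support_mulTerm_genSeries γ₀ M _)]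
  simp only [formalMul]
  rw [← (tsum_prod_pi fun j => summable_norm_mulTerm_factorCoeff hγ₀ M j (μ j)).2]
  exact tsum_congr fun ν => mulTerm_genSeries γ₀ M hμ ν

lemma prod_formalMul_factorCoeff {γ₀ : ℂ_[p]} (hγ₀ : IsDworkZero γ₀) {M : ℕ} (hMN : M ≤ N)
    (hmin : IsMinimalFor M a) {μ : Fin N → ℤ} (hμ : ∑ j, μ j • a j ∈ negInteriorLattice a) :
    ∏ j, formalMul (ofPowerSeries (theta γ₀)) (frobOne (factorCoeff γ₀ M j)) (μ j) =
      (p : ℂ_[p]) ^ M * ∏ j, factorCoeff γ₀ M j (μ j) := by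
  by_cases hpos : ∀ j : Fin N, M ≤ j.val → 0 ≤ μ j
  · have hneg := neg_of_mem_negInteriorLattice hmin hμ hpos
    have hcard : (p : ℂ_[p]) ^ M = ∏ j : Fin N, if j.val < M then (p : ℂ_[p]) else 1 := by
      rw [Finset.prod_ite, Finset.prod_const, Finset.prod_const_one, mul_one,
        Fin.card_filter_val_lt, min_eq_right hMN]
    rw [hcard, ← Finset.prod_mul_distrib]
    refine Finset.prod_congr rfl fun j _ => ?_
    rw [factorCoeff]
    split_ifs with hj
    · exact theta_formalMul_frobOne_zetaThetaCoeff hγ₀ (hneg j hj)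
    · rw [theta_formalMul_frobOne_expThetaCoeff, one_mul]
  ·
    -- both products contain a coefficient of negative degree of the power series `exp(γ₀ t) θ̂₁`
    rw [not_forall] at hpos
    obtain ⟨j, hj⟩ := hpos
    rw [Classical.not_imp, not_le] at hj
    have h0 : factorCoeff γ₀ M j = expThetaCoeff γ₀ := if_neg hj.1.not_gt
    have h1 : expThetaCoeff γ₀ (μ j) = 0 := ofPowerSeries_of_neg _ hj.2
    rw [Finset.prod_eq_zero (Finset.mem_univ j), Finset.prod_eq_zero (Finset.mem_univ j), mul_zero]
    · rw [h0, h1]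
    · rw [h0, theta_formalMul_frobOne_expThetaCoeff, h1]

lemma genSeries_ne_zero {γ₀ : ℂ_[p]} (hγ₀ : IsDworkZero γ₀) {M : ℕ} (hmin : IsMinimalFor M a) :
    genSeries γ₀ M a ≠ 0 := by
  obtain ⟨k, hk, hq⟩ := exists_zetaThetaCoeff_ne_zero hγ₀
  let μ : Fin N → ℤ := fun j => if j.val < M then k else 0
  have hμ : ∑ j, μ j • a j = k • ∑ j with j.val < M, a j := by
    simp only [μ, ite_smul, zero_smul, Finset.sum_ite, Finset.sum_const_zero, add_zero,
      Finset.smul_sum]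
  have hmem : ∑ j, μ j • a j ∈ negInteriorLattice a := by
    refine ⟨?_, sum_smul_mem_closure μ⟩
    rw [hμ, toReal_smul, ← neg_smul]
    exact smul_mem_coneInterior hmin.1 (neg_pos.2 (by exact_mod_cast hk))
  intro h
  have h1 := congrFun h (μ, ∑ j, μ j • a j)
  rw [genSeries_eq, delta_of_mem hmem, prodSubst_apply_sum, Pi.zero_apply,
    Finset.prod_eq_zero_iff] at h1
  obtain ⟨j, -, hj⟩ := h1
  by_cases hjM : j.val < M
  · rw [factorCoeff, if_pos hjM] at hj
    simp only [μ, if_pos hjM] at hj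
    exact hq hj
  · rw [factorCoeff, if_neg hjM] at hj
    simp only [μ, if_neg hjM] at hj
    have h2 := ofPowerSeries_natCast
      (PowerSeries.rescale γ₀ (PowerSeries.exp ℂ_[p]) * thetaHatOne γ₀) 0
    rw [Nat.cast_zero, PowerSeries.coeff_zero_eq_constantCoeff_apply, map_mul,
      constantCoeff_rescale, PowerSeries.constantCoeff_exp, constantCoeff_thetaHatOne] at h2
    rw [expThetaCoeff, h2] at hj
    simp at hj

end Series

end

end DworkFrobenius

theorem theorem5p1 (p : ℕ) [Fact p.Prime] (γ₀ : ℂ_[p]) (hγ₀ : DworkFrobenius.IsDworkZero γ₀)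
    (n N M : ℕ) (hMN : M ≤ N) (a : Fin N → Fin (n + 1) → ℤ)
    (ha : ∀ j, a j (Fin.last n) = 1)
    (hmin : DworkFrobenius.IsMinimalFor M a) :
    -- the one-variable product that enters the definition of `G` converges coefficientwise
    (∀ k : ℤ, Summable (DworkFrobenius.mulTerm (DworkFrobenius.zetaCoeff γ₀)
      (DworkFrobenius.ofPowerSeries (DworkFrobenius.thetaHatOne γ₀)) k)) ∧
    -- the operator is well defined on `G`
    DworkFrobenius.DworkFrobeniusConverges γ₀ a (DworkFrobenius.genSeries γ₀ M a) ∧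
    -- `G` is an eigenvector with eigenvalue `p ^ M`
    DworkFrobenius.genSeries γ₀ M a ≠ 0 ∧
    DworkFrobenius.dworkFrobenius γ₀ a (DworkFrobenius.genSeries γ₀ M a) =
      (p : ℂ_[p]) ^ M • DworkFrobenius.genSeries γ₀ M a := by
  open DworkFrobenius in
  refine ⟨fun k => summable_mulTerm_comm (summable_mulTerm hγ₀.overconvergent_thetaHatOne
    hγ₀.subexponentialGrowth_zetaCoeff k), summable_mulTerm_genSeries hγ₀ M,
    genSeries_ne_zero hγ₀ hmin, ?_⟩
  funext ⟨μ, ρ⟩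
  rw [Pi.smul_apply, smul_eq_mul, dworkFrobenius, genSeries_eq]
  by_cases hρ : ρ ∈ negInteriorLattice a
  · rw [delta_of_mem hρ, delta_of_mem hρ, ← genSeries_eq]
    by_cases h : ρ = ∑ j, μ j • a j
    · subst h
      rw [formalMul_genSeries hγ₀ M hρ, prod_formalMul_factorCoeff hγ₀ hMN hmin hρ,
        prodSubst_apply_sum]
    · rw [prodSubst_of_ne _ h, mul_zero, formalMul]
      exact (tsum_congr fun d => mulTerm_genSeries_eq_zero γ₀ M h d).trans tsum_zero
  · rw [delta_of_notMem hρ, delta_of_notMem hρ, mul_zero]
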